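/- Setting. Let $L,R\ge 0$ be integers, $\eta\in\mathbb C$, $q=e^{2\eta}$, and let $\xi_1,\dots,\xi_L\in\mathbb C$. On $(\mathbb C^2)^{\otimes L}$, with $\sigma^+=E_{12}$, $\sigma^-=E_{21}$, $\sigma^Z=\mathrm{diag}(1,-1)$ and a subscript marking the site on which a matrix acts, put $$L_n(z)=\begin{pmatrix}\sinh(z+\eta\sigma_n^Z)&\sinh(2\eta)\,\sigma_n^-\\ \sinh(2\eta)\,\sigma_n^+&\sinh(z-\eta\sigma_n^Z)\end{pmatrix},$$ $$\begin{pmatrix}A(z)&B(z)\\C(z)&D(z)\end{pmatrix}=L_L(z-\xi_L)\cdots L_2(z-\xi_2)L_1(z-\xi_1).$$ Let $|0\rangle$ be the vector with all spins up, $a(z)=\prod_n\sinh(z-\xi_n+\eta)$, $d(z)=\prod_n\sinh(z-\xi_n-\eta)$ and $f(z)=\sinh(z-2\eta)/\sinh z$. The Bethe ansatz equations for $t=(t_1,\dots,t_R)\in\mathbb C^R$ are $$\frac{a(t_j)}{d(t_j)}=\prod_{k\ne j}\frac{f(t_k-t_j)}{f(t_j-t_k)}\qquad(j=1,\dots,R),$$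 where all denominators, including those in $f$, are required to be nonzero; in particular the $t_j$ are distinct modulo $i\pi\mathbb Z$. Solutions are called regular Bethe roots at $\eta$. If moreover $|R\rangle=B(t_1)\cdots B(t_R)|0\rangle\neq 0$, then $|R\rangle$ is called a regular Bethe state. A solution is called isolated if it is an isolated point of the set of solutions in $\mathbb C^R$ for the given $\eta$ and $\xi$. For an integer $N\ge1$ let $$S^{+(N)}=\sum_{1\le j_1<\dots<j_N\le L}\ \bigotimes_{i=1}^{L}X_i,\qquad X_i=\begin{cases}\sigma^+ & \text{if } i\in\{j_1,\dots,j_N\},\\ e^{(N-2k_i)\eta\sigma^Z} & \text{otherwise},\end{cases}\qquad k_i=\#\{l:j_l<i\},$$ let $T^{+(N)}$ be the same operator with $\eta$ replaced by $-\eta$, and let $V^{\pm}=\exp\bigl(\pm\tfrac12\sum_i\xi_i\sigma_i^Z\bigr)$, $S_\xi^{+(N)}=V^+S^{+(N)}V^-$, $T_\xi^{+(N)}=V^-T^{+(N)}V^+$. Say that $q_0$ is a root of unity with $q_0^{2N}=1$ if $N\geq 1$ and either $q_0$ is a primitive $N$th root of unity with $N$ odd, or $q_0$ is a primitive $2N$th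 root of unity (with $N$ odd or even). Proposition. Let $\eta_0\in\mathbb C$, $q_0=e^{2\eta_0}$, and let $|R\rangle=B(t_1)\cdots B(t_R)|0\rangle$ be a regular Bethe state at $\eta=\eta_0$ whose Bethe roots form an isolated solution of the Bethe ansatz equations at $\eta_0$ (it is conjectured that regular Bethe roots at roots of unity always do). There is no restriction on $R$, that is, on the sector $S^Z=L/2-R$. All operators below are taken at $\eta=\eta_0$. (i) If $L$ is even and $q_0$ is a root of unity with $q_0^{2N}=1$, then $S_\xi^{+(N)}|R\rangle=T_\xi^{+(N)}|R\rangle=0$. (ii) If $L$ is odd, $N$ is odd and $q_0$ is a primitive $N$th root of unity, then $S_\xi^{+(N)}|R\rangle=T_\xi^{+(N)}|R\rangle=0$. -/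

import Mathlib

namespace XXZ

open Matrix Filter Topology

noncomputable section

/-- Spin configurations of a chain of `L` sites. The value `0` is spin up (the first basis vector of
the two-dimensional space at a site), the value `1` is spin down (the second basis vector). -/
abbrev Config (L : ℕ) : Type := Fin L → Fin 2

/-- Vectors of the `L`-fold tensor product of `ℂ²`, by their coordinates in the product basis. -/
abbrev SpinVec (L : ℕ) : Type := Config L → ℂ

/-- Operators on the `L`-fold tensor product of `ℂ²`, as matrices in the product basis. -/
abbrev SpinOp (L : ℕ) : Type := Matrix (Config L) (Config L) ℂ

/-- `σ⁺ = E₁₂`. -/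
def sigmaPlus : Matrix (Fin 2) (Fin 2) ℂ := !![0, 1; 0, 0]

/-- `σ⁻ = E₂₁`. -/
def sigmaMinus : Matrix (Fin 2) (Fin 2) ℂ := !![0, 0; 1, 0]

/-- `exp (c σᶻ)`, where `σᶻ = diag (1, -1)`. -/
def expSigmaZ (c : ℂ) : Matrix (Fin 2) (Fin 2) ℂ := !![Complex.exp c, 0; 0, Complex.exp (-c)]

/-- `sinh (z I + c σᶻ)`. -/
def sinhSigmaZ (z c : ℂ) : Matrix (Fin 2) (Fin 2) ℂ :=
  !![Complex.sinh (z + c), 0; 0, Complex.sinh (z - c)]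

/-- The tensor (Kronecker) product `M₁ ⊗ M₂ ⊗ ⋯ ⊗ M_L` of `2 × 2` matrices. -/
def siteTensor {L : ℕ} (M : Fin L → Matrix (Fin 2) (Fin 2) ℂ) : SpinOp L :=
  Matrix.of fun s s' => ∏ i, M i (s i) (s' i)

/-- The matrix `M` acting on site `n` (and the identity on all other sites). -/
def onSite {L : ℕ} (n : Fin L) (M : Matrix (Fin 2) (Fin 2) ℂ) : SpinOp L :=
  siteTensor fun i => if i = n then M else 1

/-- The `L`-operator at site `n`: a `2 × 2` matrix in the auxiliary space whose entries are
operators on the spin chain. -/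
def LOperator {L : ℕ} (η : ℂ) (n : Fin L) (z : ℂ) : Matrix (Fin 2) (Fin 2) (SpinOp L) :=
  !![onSite n (sinhSigmaZ z η), onSite n (Complex.sinh (2 * η) • sigmaMinus);
     onSite n (Complex.sinh (2 * η) • sigmaPlus), onSite n (sinhSigmaZ z (-η))]

/-- The inhomogeneous monodromy matrix `L_L(z - ξ_L) ⋯ L_2(z - ξ_2) L_1(z - ξ_1)`. -/
def monodromy {L : ℕ} (η : ℂ) (ξ : Fin L → ℂ) (z : ℂ) : Matrix (Fin 2) (Fin 2) (SpinOp L) :=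
  ((List.ofFn fun n : Fin L => LOperator η n (z - ξ n)).reverse).prod

/-- The operator `B(z)`, the upper right entry of the monodromy matrix. -/
def opB {L : ℕ} (η : ℂ) (ξ : Fin L → ℂ) (z : ℂ) : SpinOp L := monodromy η ξ z 0 1

/-- The vector `|0⟩` with all spins up. -/
def vacuum (L : ℕ) : SpinVec L := Pi.single (fun _ => 0) 1

/-- The Bethe vector `B(t_1) B(t_2) ⋯ B(t_R) |0⟩`. -/
def betheVector {L R : ℕ} (η : ℂ) (ξ : Fin L → ℂ) (t : Fin R → ℂ) : SpinVec L :=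
  ((List.ofFn fun j : Fin R => opB η ξ (t j)).prod) *ᵥ vacuum L

/-- The vacuum eigenvalue of `A(z)`. -/
def aVac {L : ℕ} (η : ℂ) (ξ : Fin L → ℂ) (z : ℂ) : ℂ := ∏ n, Complex.sinh (z - ξ n + η)

/-- The vacuum eigenvalue of `D(z)`. -/
def dVac {L : ℕ} (η : ℂ) (ξ : Fin L → ℂ) (z : ℂ) : ℂ := ∏ n, Complex.sinh (z - ξ n - η)

/-- The function `f(z) = sinh (z - 2η) / sinh z`. -/
def fBethe (η z : ℂ) : ℂ := Complex.sinh (z - 2 * η) / Complex.sinh z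

/-- `t_1, …, t_R` solve the inhomogeneous Bethe ansatz equations
`a(t_j) / d(t_j) = ∏_{k ≠ j} f(t_k - t_j) / f(t_j - t_k)`. The first three conditions say that no
denominator in these equations vanishes. -/
structure SolvesBetheEquations {L R : ℕ} (η : ℂ) (ξ : Fin L → ℂ) (t : Fin R → ℂ) : Prop where
  d_ne_zero : ∀ j, dVac η ξ (t j) ≠ 0
  sinh_ne_zero : ∀ j k, k ≠ j → Complex.sinh (t j - t k) ≠ 0
  f_ne_zero : ∀ j k, k ≠ j → fBethe η (t j - t k) ≠ 0
  equation : ∀ j, aVac η ξ (t j) / dVac η ξ (t j) =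
    ∏ k ∈ Finset.univ.erase j, fBethe η (t k - t j) / fBethe η (t j - t k)

/-- Regular Bethe roots: finite and distinct solutions of the Bethe ansatz equations. Finiteness
is automatic for complex numbers; distinctness (even modulo `iπ`) is also forced by the
non-vanishing of the denominators, and is repeated here only for readability. -/
structure IsRegularBetheRoots {L R : ℕ} (η : ℂ) (ξ : Fin L → ℂ) (t : Fin R → ℂ) : Prop where
  solves : SolvesBetheEquations η ξ t
  distinct : Function.Injective t

/-- The Bethe vector of `t` is a regular Bethe state: it is nonzero and its Bethe roots are
regular. -/
structure IsRegularBetheState {L R : ℕ} (η : ℂ) (ξ : Fin L → ℂ) (t : Fin R → ℂ) : Prop where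
  roots : IsRegularBetheRoots η ξ t
  ne_zero : betheVector η ξ t ≠ 0

/-- `t` is an isolated point of the solution set in `ℂ^R` of the Bethe ansatz equations
(at the fixed values `η`, `ξ` of the parameters). -/
def IsIsolatedBetheSolution {L R : ℕ} (η : ℂ) (ξ : Fin L → ℂ) (t : Fin R → ℂ) : Prop :=
  SolvesBetheEquations η ξ t ∧ ∀ᶠ s in 𝓝[≠] t, ¬ SolvesBetheEquations η ξ s

/-- The roots of unity conditions, called "`q` is a root of unity with `q^{2N} = 1`":
a primitive `N`th root with `N` odd, or a primitive `2N`th root with `N` odd or even. -/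
def IsRootOfUnityType (q : ℂ) (N : ℕ) : Prop :=
  0 < N ∧ ((IsPrimitiveRoot q N ∧ Odd N) ∨ (IsPrimitiveRoot q (2 * N) ∧ Odd N) ∨
    (IsPrimitiveRoot q (2 * N) ∧ Even N))

/-- `S^{+(N)}`, with `q = exp (2η)`: the sum over `j_1 < ⋯ < j_N` of the tensor products that carry
`σ⁺` at the sites `j_1, …, j_N` and `q^{(N - 2k) σᶻ / 2} = exp ((N - 2k) η σᶻ)` at every other site,
where `k` is the number of the `j`'s to the left of that site. -/
def SPlus (L N : ℕ) (η : ℂ) : SpinOp L :=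
  ∑ J ∈ Finset.powersetCard N (Finset.univ : Finset (Fin L)),
    siteTensor fun i => if i ∈ J then sigmaPlus
      else expSigmaZ (((N : ℂ) - 2 * ((J.filter (· < i)).card : ℂ)) * η)

/-- `T^{+(N)}`, with `q = exp (2η)`: the same as `S^{+(N)}` with `q` replaced by `q⁻¹`, i.e. with
`q^{-(N - 2k) σᶻ / 2} = exp (-(N - 2k) η σᶻ)` at the other sites. -/
def TPlus (L N : ℕ) (η : ℂ) : SpinOp L :=
  ∑ J ∈ Finset.powersetCard N (Finset.univ : Finset (Fin L)),
    siteTensor fun i => if i ∈ J then sigmaPlus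
      else expSigmaZ (-(((N : ℂ) - 2 * ((J.filter (· < i)).card : ℂ)) * η))

/-- The diagonal operator `V⁺ = exp (∑ ξ_i σᶻ_i / 2)`. -/
def VPlus {L : ℕ} (ξ : Fin L → ℂ) : SpinOp L := siteTensor fun i => expSigmaZ (ξ i / 2)

/-- The diagonal operator `V⁻ = exp (-∑ ξ_i σᶻ_i / 2)`, the inverse of `V⁺`. -/
def VMinus {L : ℕ} (ξ : Fin L → ℂ) : SpinOp L := siteTensor fun i => expSigmaZ (-(ξ i / 2))

/-- `S_ξ^{+(N)} = V⁺ S^{+(N)} V⁻`. -/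
def SPlusXi {L : ℕ} (N : ℕ) (η : ℂ) (ξ : Fin L → ℂ) : SpinOp L :=
  VPlus ξ * SPlus L N η * VMinus ξ

/-- `T_ξ^{+(N)} = V⁻ T^{+(N)} V⁺`. -/
def TPlusXi {L : ℕ} (N : ℕ) (η : ℂ) (ξ : Fin L → ℂ) : SpinOp L :=
  VMinus ξ * TPlus L N η * VPlus ξ

end

end XXZ

/-!
The divided powers `S_ξ^{+(N)}` act explicitly on every off-shell Bethe vector: for all `η` and all
admissible `t`,
`S_ξ^{+(N)} B(t_1) ⋯ B(t_R) |0⟩ = ∑_S c_S ∏_{l ∉ S} B(t_l) |0⟩`,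
the sum being over the sets `S` of `N` roots, where with `ρ = exp ((L - 2 R + N + 1) η)` the
coefficient `c_S` is the sum over the subsets `I` of `S` of
`(-1)^{N - |I|} ρ^{N - 2 |I|} ∏_{i ∈ I} α_i ∏_{j ∈ S \ I} δ_j ∏_{i ∈ I, j ∈ S \ I} f (t_i - t_j)`,
with `α_i = exp (t_i) a(t_i) ∏_{l ∉ S} f (t_i - t_l)` and
`δ_j = exp (t_j) d(t_j) ∏_{l ∉ S} f (t_l - t_j)` (`SPlusXi_mulVec_betheVector`, `removalCoeff`).

The formula for `N = 1` follows from the `RTT` relations (`monodromy_rtt`) and from the commutation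
of the quantum group generator with the monodromy matrix (`SPlusXi_one_mul_monodromy`). The
recursion `[n + 1] S^{+(n+1)} = S^{+(n)} S^{+(1)}` (`SPlusXi_mul_SPlusXi_one`), which the
coefficients also satisfy (`removalSum_recursion`), gives it for all `N` when `q` is generic. Both
sides are continuous in `η`, so the formula persists at roots of unity; as it holds off shell, `t`
stays fixed in this limit.

At a root of unity, the Bethe equations turn `c_S` into a multiple of
`∑_m (-1)^{N - m} ρ^{N - 2 m} E_m`, where `E_m` is the sum over the subsets `I` of `S` of size `m` of
`∏_{i ∈ I, j ∈ S \ I} f (t_j - t_i)`. This is the symmetric `q`-binomial coefficient of `N` over `m`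
(`prod_sinh_mul_crossSum`), so it vanishes for `0 < m < N`, and the two remaining terms cancel
because of the parities of `L` and `N` (`removalCoeff_eq_zero`). The statement for `T_ξ^{+(N)}` is
that for `S_ξ^{+(N)}` after the reflection `(η, ξ, t) ↦ (-η, -ξ, -t)`.
-/

namespace XXZ

open Matrix Filter Topology

noncomputable section

/-! ### Splitting off the last site -/

/-- An operator on `L + 1` sites, as a `2 × 2` matrix (in the space of the last site) of operators on
the first `L` sites. -/
def lastBlocks {L : ℕ} : SpinOp (L + 1) ≃ₐ[ℂ] Matrix (Fin 2) (Fin 2) (SpinOp L) :=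
  (Matrix.reindexAlgEquiv ℂ ℂ (Fin.snocEquiv fun _ : Fin (L + 1) => Fin 2).symm).trans
    (Matrix.compAlgEquiv (Fin 2) (Config L) ℂ ℂ).symm

theorem lastBlocks_apply {L : ℕ} (X : SpinOp (L + 1)) (i j : Fin 2) (s s' : Config L) :
    lastBlocks X i j s s' = X (Fin.snoc s i : Config (L + 1)) (Fin.snoc s' j : Config (L + 1)) :=
  rfl

theorem lastBlocks_siteTensor {L : ℕ} (M : Fin (L + 1) → Matrix (Fin 2) (Fin 2) ℂ) (i j : Fin 2) :
    lastBlocks (siteTensor M) i j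
      = M (Fin.last L) i j • siteTensor fun n : Fin L => M n.castSucc := by
  ext s s'
  simp [lastBlocks_apply, siteTensor, Fin.prod_univ_castSucc, mul_comm]

theorem siteTensor_one (L : ℕ) : siteTensor (fun _ : Fin L => 1) = 1 := by
  ext s s'
  simp only [siteTensor, of_apply, Matrix.one_apply, Finset.prod_ite_zero]
  simp [funext_iff]

theorem siteTensor_mul {L : ℕ} (M M' : Fin L → Matrix (Fin 2) (Fin 2) ℂ) :
    siteTensor M * siteTensor M' = siteTensor fun n => M n * M' n := by
  ext s s'
  simp only [siteTensor, Matrix.mul_apply, of_apply, ← Finset.prod_mul_distrib]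
  rw [Finset.prod_univ_sum]
  simp

theorem siteTensor_smul {L : ℕ} (c : Fin L → ℂ) (M : Fin L → Matrix (Fin 2) (Fin 2) ℂ) :
    (siteTensor fun n => c n • M n) = (∏ n, c n) • siteTensor M := by
  ext s s'
  simp [siteTensor, Finset.prod_mul_distrib]

/-- An operator on the first `L` sites, acting on `L + 1` sites. -/
def extendOp {L : ℕ} : SpinOp L →+* SpinOp (L + 1) :=
  (lastBlocks (L := L)).symm.toRingEquiv.toRingHom.comp (Matrix.scalar (Fin 2))

theorem lastBlocks_extendOp {L : ℕ} (X : SpinOp L) :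
    lastBlocks (extendOp X) = Matrix.scalar (Fin 2) X := by
  simp [extendOp]

theorem onSite_castSucc {L : ℕ} (n : Fin L) (M : Matrix (Fin 2) (Fin 2) ℂ) :
    onSite n.castSucc M = extendOp (onSite n M) := by
  apply (lastBlocks (L := L)).injective
  rw [lastBlocks_extendOp]
  ext1 i j
  rw [onSite, lastBlocks_siteTensor, if_neg (Fin.castSucc_lt_last n).ne']
  simp only [Fin.castSucc_inj]
  by_cases h : i = j
  · subst h; simp [onSite]
  · simp [h]

theorem lastBlocks_onSite_last {L : ℕ} (M : Matrix (Fin 2) (Fin 2) ℂ) :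
    lastBlocks (onSite (Fin.last L) M) = of fun i j => M i j • (1 : SpinOp L) := by
  ext1 i j
  rw [onSite, lastBlocks_siteTensor]
  simp only [if_true, (Fin.castSucc_lt_last _).ne, if_false, siteTensor_one, of_apply]

/-- The matrix elements, in the space of one site, of the four entries of the `L`-operator. -/
def localL (η z : ℂ) : Matrix (Fin 2) (Fin 2) (Matrix (Fin 2) (Fin 2) ℂ) :=
  !![sinhSigmaZ z η, Complex.sinh (2 * η) • sigmaMinus;
     Complex.sinh (2 * η) • sigmaPlus, sinhSigmaZ z (-η)]

theorem LOperator_apply {L : ℕ} (η : ℂ) (n : Fin L) (z : ℂ) (a b : Fin 2) :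
    LOperator η n z a b = onSite n (localL η z a b) := by
  fin_cases a <;> fin_cases b <;> rfl

theorem monodromy_succ {L : ℕ} (η : ℂ) (ξ : Fin (L + 1) → ℂ) (z : ℂ) :
    monodromy η ξ z = LOperator η (Fin.last L) (z - ξ (Fin.last L)) *
      (monodromy η (fun n : Fin L => ξ n.castSucc) z).map extendOp := by
  have h : (monodromy η (fun n : Fin L => ξ n.castSucc) z).map extendOp
      = (RingHom.mapMatrix extendOp) (monodromy η (fun n : Fin L => ξ n.castSucc) z) := rfl
  rw [h, monodromy, monodromy, map_list_prod, List.ofFn_succ']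
  simp only [List.concat_eq_append, List.reverse_append, List.reverse_cons, List.reverse_nil,
    List.nil_append, List.singleton_append, List.prod_cons, List.map_reverse, List.map_ofFn]
  congr 5
  funext n
  ext1 a b
  simp [LOperator_apply, onSite_castSucc]

theorem lastBlocks_monodromy {L : ℕ} (η : ℂ) (ξ : Fin (L + 1) → ℂ) (z : ℂ) (a c i j : Fin 2) :
    lastBlocks (monodromy η ξ z a c) i j = ∑ e, localL η (z - ξ (Fin.last L)) a e i j •
      monodromy η (fun n : Fin L => ξ n.castSucc) z e c := by
  rw [monodromy_succ, Matrix.mul_apply, map_sum, Matrix.sum_apply]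
  refine Finset.sum_congr rfl fun e _ => ?_
  rw [map_mul, LOperator_apply, lastBlocks_onSite_last, map_apply, lastBlocks_extendOp]
  simp

/-! ### The quadratic relations of the monodromy matrix -/

/-- The six-vertex `R`-matrix, as a function of the rows `(x, y)` and the columns `(a, b)`. -/
def rMatrix (η w : ℂ) (x y a b : Fin 2) : ℂ :=
  if x = y then (if a = x ∧ b = x then Complex.sinh (w + 2 * η) else 0)
  else if a = x ∧ b = y then Complex.sinh w
  else if a = y ∧ b = x then Complex.sinh (2 * η) else 0

/-- The `RLL` relation of one site. -/
theorem localL_rtt (η u v : ℂ) (x y e g i j : Fin 2) :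
    ∑ a, ∑ b, rMatrix η (u - v) x y a b * (localL η u a e * localL η v b g) i j
      = ∑ a, ∑ b, rMatrix η (u - v) a b e g * (localL η v y b * localL η u x a) i j := by
  have hX := Complex.exp_ne_zero u
  have hY := Complex.exp_ne_zero v
  have hQ := Complex.exp_ne_zero η
  fin_cases x <;> fin_cases y <;> fin_cases e <;> fin_cases g <;> fin_cases i <;> fin_cases j <;>
    simp [Fin.sum_univ_two, rMatrix, localL, sinhSigmaZ, sigmaPlus, sigmaMinus,
      -mul_eq_mul_left_iff] <;>
    simp only [Complex.sinh, two_mul, sub_eq_add_neg, neg_add, neg_neg, Complex.exp_add,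
      Complex.exp_neg] <;>
    generalize Complex.exp u = X at * <;> generalize Complex.exp v = Y at * <;>
    generalize Complex.exp η = Q at * <;> field_simp <;> ring

theorem lastBlocks_monodromy_mul {L : ℕ} (η : ℂ) (ξ : Fin (L + 1) → ℂ) (u v : ℂ)
    (a b c d i j : Fin 2) :
    lastBlocks (monodromy η ξ u a c * monodromy η ξ v b d) i j
      = ∑ e, ∑ g, (localL η (u - ξ (Fin.last L)) a e * localL η (v - ξ (Fin.last L)) b g) i j •
        (monodromy η (fun n : Fin L => ξ n.castSucc) u e c *
          monodromy η (fun n : Fin L => ξ n.castSucc) v g d) := by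
  rw [map_mul, Matrix.mul_apply]
  simp only [lastBlocks_monodromy, Finset.sum_mul_sum, smul_mul_smul_comm, Matrix.mul_apply,
    Finset.sum_smul]
  rw [Finset.sum_comm]
  exact Finset.sum_congr rfl fun e _ => Finset.sum_comm

/-- The `RTT` relations `R(u - v) T₁(u) T₂(v) = T₂(v) T₁(u) R(u - v)`. They pass from `L` to `L + 1`
sites because the operators of the last site commute with those of the others. -/
theorem monodromy_rtt {L : ℕ} (η : ℂ) (ξ : Fin L → ℂ) (u v : ℂ) (x y c d : Fin 2) :
    ∑ a, ∑ b, rMatrix η (u - v) x y a b • (monodromy η ξ u a c * monodromy η ξ v b d)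
      = ∑ a, ∑ b, rMatrix η (u - v) a b c d • (monodromy η ξ v y b * monodromy η ξ u x a) := by
  induction L generalizing x y c d with
  | zero =>
    have h : ∀ z, monodromy η ξ z = 1 := fun z => by simp [monodromy]
    simp only [h]
    fin_cases x <;> fin_cases y <;> fin_cases c <;> fin_cases d <;>
      simp [rMatrix, Matrix.one_apply]
  | succ L ih =>
    apply (lastBlocks (L := L)).injective
    ext1 i j
    simp only [map_sum, map_smul, Matrix.sum_apply, Matrix.smul_apply, lastBlocks_monodromy_mul]
    set ξ' : Fin L → ℂ := fun n => ξ n.castSucc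
    set r := ξ (Fin.last L)
    have hw : u - v = (u - r) - (v - r) := by ring
    calc _ = ∑ e, ∑ g, (∑ a, ∑ b, rMatrix η (u - v) x y a b *
            (localL η (u - r) a e * localL η (v - r) b g) i j) •
            (monodromy η ξ' u e c * monodromy η ξ' v g d) := by
          simp only [Finset.smul_sum, Finset.sum_smul, smul_smul]
          simp only [Fin.sum_univ_two]
          abel
      _ = ∑ a, ∑ b, (localL η (v - r) y b * localL η (u - r) x a) i j •
            (∑ e, ∑ g, rMatrix η (u - v) a b e g •
              (monodromy η ξ' u e c * monodromy η ξ' v g d)) := by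
          simp only [hw, localL_rtt, Finset.smul_sum, Finset.sum_smul, smul_smul]
          simp only [Fin.sum_univ_two, mul_comm]
          abel
      _ = _ := by
          simp only [ih ξ']
          simp only [Finset.smul_sum, smul_smul]
          simp only [Fin.sum_univ_two, mul_comm]
          abel

/-! ### The total spin operator and the divided powers on one more site -/

/-- `exp (c ∑ σᶻ_n)`, the exponential of the total spin. -/
def expSpin (L : ℕ) (c : ℂ) : SpinOp L := siteTensor fun _ => expSigmaZ c

theorem lastBlocks_expSpin (L : ℕ) (c : ℂ) :
    lastBlocks (expSpin (L + 1) c)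
      = !![Complex.exp c • expSpin L c, 0; 0, Complex.exp (-c) • expSpin L c] := by
  ext1 i j
  rw [expSpin, lastBlocks_siteTensor]
  fin_cases i <;> fin_cases j <;> simp [expSigmaZ, expSpin]

theorem expSigmaZ_mul (c c' : ℂ) : expSigmaZ c * expSigmaZ c' = expSigmaZ (c + c') := by
  ext i j
  fin_cases i <;> fin_cases j <;> simp [expSigmaZ, Complex.exp_add, mul_comm]

theorem expSigmaZ_mul_sigmaPlus (c : ℂ) :
    expSigmaZ c * sigmaPlus = Complex.exp c • sigmaPlus := by
  ext i j
  fin_cases i <;> fin_cases j <;> simp [expSigmaZ, sigmaPlus]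

theorem sigmaPlus_mul_expSigmaZ (c : ℂ) :
    sigmaPlus * expSigmaZ c = Complex.exp (-c) • sigmaPlus := by
  ext i j
  fin_cases i <;> fin_cases j <;> simp [expSigmaZ, sigmaPlus]

theorem expSigmaZ_zero : expSigmaZ 0 = 1 := by
  simp [expSigmaZ, Matrix.one_fin_two]

/-- The summand of `S_ξ^{+(N)}` that carries `σ⁺` at the sites in `J`. -/
def sTerm {L : ℕ} (N : ℕ) (η : ℂ) (ξ : Fin L → ℂ) (J : Finset (Fin L)) : SpinOp L :=
  siteTensor fun i => if i ∈ J then Complex.exp (ξ i) • sigmaPlus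
    else expSigmaZ (((N : ℂ) - 2 * ((J.filter (· < i)).card : ℂ)) * η)

theorem SPlusXi_eq_sum {L : ℕ} (N : ℕ) (η : ℂ) (ξ : Fin L → ℂ) :
    SPlusXi N η ξ = ∑ J ∈ Finset.powersetCard N Finset.univ, sTerm N η ξ J := by
  rw [SPlusXi, SPlus, Finset.mul_sum, Finset.sum_mul]
  refine Finset.sum_congr rfl fun J _ => ?_
  rw [VPlus, VMinus, siteTensor_mul, siteTensor_mul, sTerm]
  congr 1
  funext i
  split_ifs
  · rw [expSigmaZ_mul_sigmaPlus, smul_mul_assoc, sigmaPlus_mul_expSigmaZ, smul_smul,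
      ← Complex.exp_add]
    congr 2
    ring
  · rw [expSigmaZ_mul, expSigmaZ_mul]
    congr 1
    ring

theorem SPlusXi_zero {L : ℕ} (η : ℂ) (ξ : Fin L → ℂ) : SPlusXi 0 η ξ = 1 := by
  simp [SPlusXi_eq_sum, sTerm, expSigmaZ_zero, siteTensor_one]

theorem expSpin_mul_sTerm {L N : ℕ} (η : ℂ) (ξ : Fin L → ℂ) {J : Finset (Fin L)}
    (hJ : J.card = N) :
    expSpin L η * sTerm N η ξ J
      = Complex.exp (N * η) • siteTensor fun i => if i ∈ J then Complex.exp (ξ i) • sigmaPlus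
        else expSigmaZ ((((N + 1 : ℕ) : ℂ) - 2 * ((J.filter (· < i)).card : ℂ)) * η) := by
  have h : Complex.exp (N * η) = ∏ i, if i ∈ J then Complex.exp η else 1 := by
    rw [Finset.prod_ite_mem, Finset.univ_inter, Finset.prod_const, hJ, Complex.exp_nat_mul]
  rw [h, ← siteTensor_smul, expSpin, sTerm, siteTensor_mul]
  congr 1
  funext i
  split_ifs
  · rw [Matrix.mul_smul, expSigmaZ_mul_sigmaPlus, smul_comm]
  · rw [expSigmaZ_mul, one_smul]
    congr 1
    push_cast
    ring

theorem lastBlocks_sTerm_map {L n : ℕ} (η : ℂ) (ξ : Fin (L + 1) → ℂ) {J : Finset (Fin L)}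
    (hJ : J.card = n) :
    lastBlocks (sTerm n η ξ (J.map Fin.castSuccEmb))
      = !![Complex.exp (-(n * η)) • sTerm n η (fun i => ξ i.castSucc) J, 0;
          0, Complex.exp (n * η) • sTerm n η (fun i => ξ i.castSucc) J] := by
  have h1 : Fin.last L ∉ J.map Fin.castSuccEmb := by simp [Fin.castSucc_ne_last]
  have h2 : (J.map Fin.castSuccEmb).filter (· < Fin.last L) = J.map Fin.castSuccEmb :=
    Finset.filter_true_of_mem (by simp [Fin.castSucc_lt_last])
  have h3 : ∀ i : Fin L, ((J.map Fin.castSuccEmb).filter (· < i.castSucc)).card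
      = (J.filter (· < i)).card := fun i => by
    rw [Finset.filter_map, Finset.card_map]
    rfl
  have h4 : ∀ i : Fin L, i.castSucc ∈ J.map Fin.castSuccEmb ↔ i ∈ J := fun i => by simp
  have h5 : ((n : ℂ) - 2 * n) * η = -(n * η) := by ring
  ext1 i j
  rw [sTerm, lastBlocks_siteTensor]
  simp only [if_neg h1, h2, Finset.card_map, hJ, h3, h4, h5]
  fin_cases i <;> fin_cases j <;> simp [expSigmaZ, sTerm]

theorem lastBlocks_sTerm_insert {L n : ℕ} (η : ℂ) (ξ : Fin (L + 1) → ℂ) {J : Finset (Fin L)}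
    (hJ : J.card = n) :
    lastBlocks (sTerm (n + 1) η ξ (insert (Fin.last L) (J.map Fin.castSuccEmb)))
      = !![0, Complex.exp (ξ (Fin.last L) - n * η) •
          (expSpin L η * sTerm n η (fun i => ξ i.castSucc) J); 0, 0] := by
  have h3 : ∀ i : Fin L, ((insert (Fin.last L) (J.map Fin.castSuccEmb)).filter
      (· < i.castSucc)).card = (J.filter (· < i)).card := fun i => by
    rw [Finset.filter_insert, if_neg (Fin.castSucc_lt_last i).not_gt, Finset.filter_map,
      Finset.card_map]
    rfl
  have h4 : ∀ i : Fin L, i.castSucc ∈ insert (Fin.last L) (J.map Fin.castSuccEmb) ↔ i ∈ J :=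
    fun i => by simp [Fin.castSucc_ne_last]
  ext1 i j
  rw [sTerm, lastBlocks_siteTensor, expSpin_mul_sTerm η _ hJ, smul_smul, ← Complex.exp_add,
    sub_add_cancel]
  simp only [Finset.mem_insert_self, if_true, h3, h4]
  fin_cases i <;> fin_cases j <;> simp [sigmaPlus]

/-- The coproduct of the divided powers, with the last site split off. -/
theorem lastBlocks_SPlusXi_succ {L : ℕ} (n : ℕ) (η : ℂ) (ξ : Fin (L + 1) → ℂ) :
    lastBlocks (SPlusXi (n + 1) η ξ)
      = !![Complex.exp (-((n + 1 : ℕ) * η)) • SPlusXi (n + 1) η (fun i : Fin L => ξ i.castSucc),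
          Complex.exp (ξ (Fin.last L) - n * η) •
            (expSpin L η * SPlusXi n η (fun i : Fin L => ξ i.castSucc));
          0, Complex.exp ((n + 1 : ℕ) * η) • SPlusXi (n + 1) η (fun i : Fin L => ξ i.castSucc)] := by
  have hl : ∀ J : Finset (Fin L), Fin.last L ∉ J.map Fin.castSuccEmb := fun J => by
    simp [Fin.castSucc_ne_last]
  have hu : (Finset.univ : Finset (Fin (L + 1)))
      = insert (Fin.last L) ((Finset.univ : Finset (Fin L)).map Fin.castSuccEmb) := by
    rw [Fin.univ_castSuccEmb, Finset.cons_eq_insert]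
  have hd : Disjoint (Finset.powersetCard (n + 1) ((Finset.univ : Finset (Fin L)).map
        Fin.castSuccEmb))
      ((Finset.powersetCard n ((Finset.univ : Finset (Fin L)).map Fin.castSuccEmb)).image
        (insert (Fin.last L))) := by
    rw [Finset.disjoint_left]
    rintro J hJ hJ'
    obtain ⟨J', -, rfl⟩ := Finset.mem_image.1 hJ'
    exact hl _ ((Finset.mem_powersetCard.1 hJ).1 (Finset.mem_insert_self _ _))
  rw [SPlusXi_eq_sum, hu, Finset.powersetCard_succ_insert (hl _), Finset.sum_union hd,
    Finset.sum_image, Finset.powersetCard_map, Finset.powersetCard_map, Finset.sum_map,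
    Finset.sum_map, map_add, map_sum, map_sum]
  · simp only [RelEmbedding.coe_toEmbedding, Finset.mapEmbedding_apply]
    rw [Finset.sum_congr rfl fun J hJ => lastBlocks_sTerm_map η ξ (Finset.mem_powersetCard.1 hJ).2,
      Finset.sum_congr rfl fun J hJ =>
        lastBlocks_sTerm_insert η ξ (Finset.mem_powersetCard.1 hJ).2]
    ext1 i j
    simp only [Matrix.add_apply, Matrix.sum_apply, SPlusXi_eq_sum, Finset.mul_sum, Finset.smul_sum]
    fin_cases i <;> fin_cases j <;> simp
  · intro J hJ J' hJ' h
    have hn : ∀ K ∈ Finset.powersetCard n ((Finset.univ : Finset (Fin L)).map Fin.castSuccEmb),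
        Fin.last L ∉ K := fun K hK hK' => hl _ ((Finset.mem_powersetCard.1 hK).1 hK')
    rw [← Finset.erase_insert (hn J hJ), ← Finset.erase_insert (hn J' hJ'), h]

section Blocks

variable {L : ℕ} (η : ℂ) (ξ : Fin (L + 1) → ℂ) (z : ℂ)

theorem lastBlocks_monodromy_zero (c : Fin 2) :
    lastBlocks (monodromy η ξ z 0 c) =
      !![Complex.sinh (z - ξ (Fin.last L) + η) • monodromy η (fun n => ξ n.castSucc) z 0 c, 0;
        Complex.sinh (2 * η) • monodromy η (fun n => ξ n.castSucc) z 1 c,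
        Complex.sinh (z - ξ (Fin.last L) - η) • monodromy η (fun n => ξ n.castSucc) z 0 c] := by
  ext1 i j
  rw [lastBlocks_monodromy]
  fin_cases i <;> fin_cases j <;> simp [localL, sinhSigmaZ, sigmaMinus]

theorem lastBlocks_monodromy_one (c : Fin 2) :
    lastBlocks (monodromy η ξ z 1 c) =
      !![Complex.sinh (z - ξ (Fin.last L) - η) • monodromy η (fun n => ξ n.castSucc) z 1 c,
        Complex.sinh (2 * η) • monodromy η (fun n => ξ n.castSucc) z 0 c;
        0, Complex.sinh (z - ξ (Fin.last L) + η) • monodromy η (fun n => ξ n.castSucc) z 1 c] := by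
  ext1 i j
  rw [lastBlocks_monodromy]
  fin_cases i <;> fin_cases j <;> simp [localL, sinhSigmaZ, sigmaPlus, sub_eq_add_neg]

end Blocks

/-! ### Commutation with the total spin -/

theorem expSpin_mul_monodromy {L : ℕ} (η c : ℂ) (ξ : Fin L → ℂ) (z : ℂ) :
    expSpin L c * monodromy η ξ z 0 0 = monodromy η ξ z 0 0 * expSpin L c ∧
    expSpin L c * monodromy η ξ z 0 1
      = Complex.exp (-(2 * c)) • (monodromy η ξ z 0 1 * expSpin L c) ∧
    expSpin L c * monodromy η ξ z 1 0
      = Complex.exp (2 * c) • (monodromy η ξ z 1 0 * expSpin L c) ∧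
    expSpin L c * monodromy η ξ z 1 1 = monodromy η ξ z 1 1 * expSpin L c := by
  have he := Complex.exp_ne_zero c
  induction L with
  | zero => simp [monodromy]
  | succ L ih =>
    obtain ⟨hA, hB, hC, hD⟩ := ih fun n => ξ n.castSucc
    simp only [two_mul, neg_add, Complex.exp_add, Complex.exp_neg] at hB hC ⊢
    refine ⟨?_, ?_, ?_, ?_⟩ <;>
    · apply (lastBlocks (L := L)).injective
      simp only [map_mul, map_smul, lastBlocks_expSpin, lastBlocks_monodromy_zero,
        lastBlocks_monodromy_one]
      ext1 i j
      fin_cases i <;> fin_cases j <;>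
        simp [hA, hB, hC, hD, Complex.exp_neg] <;> match_scalars <;> field_simp

theorem expSpin_mul_SPlusXi {L : ℕ} (n : ℕ) (η c : ℂ) (ξ : Fin L → ℂ) :
    expSpin L c * SPlusXi n η ξ = Complex.exp (n * (2 * c)) • (SPlusXi n η ξ * expSpin L c) := by
  rw [SPlusXi_eq_sum, Finset.mul_sum, Finset.sum_mul, Finset.smul_sum]
  refine Finset.sum_congr rfl fun J hJ => ?_
  have h : Complex.exp (n * (2 * c)) = ∏ i, if i ∈ J then Complex.exp (2 * c) else 1 := by
    rw [Finset.prod_ite_mem, Finset.univ_inter, Finset.prod_const, (Finset.mem_powersetCard.1 hJ).2,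
      Complex.exp_nat_mul]
  rw [h, expSpin, sTerm, siteTensor_mul, siteTensor_mul, ← siteTensor_smul]
  congr 1
  funext i
  split_ifs
  · rw [Matrix.mul_smul, expSigmaZ_mul_sigmaPlus, Matrix.smul_mul, sigmaPlus_mul_expSigmaZ]
    simp only [smul_smul, ← Complex.exp_add]
    congr 2
    ring
  · rw [expSigmaZ_mul, expSigmaZ_mul, one_smul, add_comm]

/-! ### Commutation of the quantum group generator with the monodromy matrix -/

theorem SPlusXi_eq_zero {L n : ℕ} (h : L < n) (η : ℂ) (ξ : Fin L → ℂ) : SPlusXi n η ξ = 0 := by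
  rw [SPlusXi_eq_sum, Finset.powersetCard_eq_empty.2 (by simpa using h), Finset.sum_empty]

/-- The commutators of the generator `S_ξ^{+(1)}` with `B(z)` and `D(z)`. The relation for `D` is
needed to carry the one for `B` over to one more site. -/
theorem SPlusXi_one_mul_monodromy {L : ℕ} (η : ℂ) (ξ : Fin L → ℂ) (z : ℂ) :
    SPlusXi 1 η ξ * monodromy η ξ z 0 1 = monodromy η ξ z 0 1 * SPlusXi 1 η ξ
      + Complex.exp z • (monodromy η ξ z 0 0 * expSpin L (-η) - expSpin L η * monodromy η ξ z 1 1) ∧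
    Complex.exp η • (SPlusXi 1 η ξ * monodromy η ξ z 1 1)
      = Complex.exp (-η) • (monodromy η ξ z 1 1 * SPlusXi 1 η ξ)
        + Complex.exp (z - η) • (monodromy η ξ z 1 0 * expSpin L (-η)) := by
  induction L with
  | zero =>
    have h : ∀ c, expSpin 0 c = 1 := fun c => by
      ext s s'
      rw [Subsingleton.elim s s']
      simp [expSpin, siteTensor]
    simp [SPlusXi_eq_zero, monodromy, h]
  | succ L ih =>
    obtain ⟨-, hB, -, hD⟩ := expSpin_mul_monodromy η η (fun n : Fin L => ξ n.castSucc) z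
    obtain ⟨hSB, hSD⟩ := ih fun n => ξ n.castSucc
    have hX := Complex.exp_ne_zero (ξ (Fin.last L))
    -- in terms of `w` all coefficients are rational in `exp w`, `exp η` and `exp (ξ (Fin.last L))`
    obtain ⟨w, rfl⟩ : ∃ w, z = w + ξ (Fin.last L) := ⟨z - ξ (Fin.last L), by ring⟩
    have hW := Complex.exp_ne_zero w
    have hE := Complex.exp_ne_zero η
    constructor <;>
    · apply (lastBlocks (L := L)).injective
      simp only [map_mul, map_smul, map_add, map_sub, lastBlocks_expSpin, lastBlocks_monodromy_zero,
        lastBlocks_monodromy_one, lastBlocks_SPlusXi_succ 0, SPlusXi_zero]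
      simp only [zero_add, mul_one]
      generalize SPlusXi 1 η (fun n : Fin L => ξ n.castSucc) = S at *
      generalize monodromy η (fun n : Fin L => ξ n.castSucc) (w + ξ (Fin.last L)) = T at *
      simp only [two_mul, neg_add, Complex.exp_add, Complex.exp_neg, Complex.exp_sub,
        Complex.sinh, add_sub_cancel_right] at hB hSB hSD ⊢
      rw [← eq_inv_smul_iff₀ hE] at hSD
      ext1 i j
      fin_cases i <;> fin_cases j <;> simp [hD, hB, hSB, hSD] <;>
        match_scalars <;> field_simp <;> ring

/-- `S_ξ^{+(n)}` is a divided power: `[n + 1] S_ξ^{+(n+1)} = S_ξ^{+(n)} S_ξ^{+(1)}`. -/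
theorem SPlusXi_mul_SPlusXi_one {L : ℕ} (n : ℕ) (η : ℂ) (ξ : Fin L → ℂ) :
    Complex.sinh (2 * η) • (SPlusXi n η ξ * SPlusXi 1 η ξ)
      = Complex.sinh (2 * (n + 1 : ℕ) * η) • SPlusXi (n + 1) η ξ := by
  induction L generalizing n with
  | zero => cases n <;> simp [SPlusXi_eq_zero, SPlusXi_zero]
  | succ L ih =>
    cases n with
    | zero => simp [SPlusXi_zero]
    | succ n =>
      have hK := expSpin_mul_SPlusXi (n + 1) η η (fun i : Fin L => ξ i.castSucc)
      have h1 := ih (ξ := fun i => ξ i.castSucc) (n := n)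
      have h2 := ih (ξ := fun i => ξ i.castSucc) (n := n + 1)
      apply (lastBlocks (L := L)).injective
      simp only [map_mul, map_smul, lastBlocks_SPlusXi_succ, lastBlocks_SPlusXi_succ 0,
        SPlusXi_zero]
      generalize expSpin L η = K at *
      generalize SPlusXi 1 η (fun i : Fin L => ξ i.castSucc) = S at *
      generalize SPlusXi n η (fun i : Fin L => ξ i.castSucc) = S₀ at *
      generalize SPlusXi (n + 1) η (fun i : Fin L => ξ i.castSucc) = S₁ at *
      generalize SPlusXi (n + 1 + 1) η (fun i : Fin L => ξ i.castSucc) = S₂ at *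
      have h3 := congrArg (K * ·) h1
      have hE := Complex.exp_ne_zero η
      have hP := Complex.exp_ne_zero (n * η)
      simp only [Matrix.mul_smul, ← mul_assoc, Nat.cast_add, Nat.cast_one, Complex.sinh, two_mul, add_mul,
        neg_add, one_mul, mul_add, Complex.exp_add, Complex.exp_neg, Complex.exp_sub] at h2 h3 hK ⊢
      ext1 i j
      fin_cases i <;> fin_cases j
      · simp
        linear_combination (norm := (match_scalars <;> field_simp <;> ring))
          ((Complex.exp (n * η))⁻¹ * (Complex.exp η)⁻¹ * (Complex.exp η)⁻¹) • h2
      · simp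
        linear_combination (norm := (match_scalars <;> field_simp <;> ring))
          (Complex.exp (ξ (Fin.last L)) * (Complex.exp (n * η))⁻¹ * Complex.exp η) • h3
          - ((Complex.exp η ^ 2 - (Complex.exp η)⁻¹ ^ 2) / 2 * Complex.exp (ξ (Fin.last L)) *
            (Complex.exp (n * η))⁻¹ ^ 3 * (Complex.exp η)⁻¹ ^ 3) • hK
      · simp
      · simp
        linear_combination (norm := (match_scalars <;> field_simp <;> ring))
          (Complex.exp (n * η) * Complex.exp η * Complex.exp η) • h2

/-! ### Symmetrised products of the functions `f` -/

section Sums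

variable {ι M : Type*} [DecidableEq ι] [AddCommMonoid M]

/-- Choosing a subset and then one of its elements is choosing an element and then the rest. -/
theorem sum_powersetCard_succ_sum (S : Finset ι) (n : ℕ) (F : ι → Finset ι → M) :
    ∑ I ∈ S.powersetCard (n + 1), ∑ i ∈ I, F i (I.erase i)
      = ∑ i ∈ S, ∑ I ∈ (S.erase i).powersetCard n, F i I := by
  rw [Finset.sum_sigma', Finset.sum_sigma']
  refine Finset.sum_bij' (fun p _ => ⟨p.2, p.1.erase p.2⟩) (fun p _ => ⟨insert p.1 p.2, p.1⟩)
    ?_ ?_ ?_ ?_ ?_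
  · rintro ⟨I, i⟩ h
    simp only [Finset.mem_sigma, Finset.mem_powersetCard] at h ⊢
    exact ⟨h.1.1 h.2, Finset.erase_subset_erase _ h.1.1, by
      rw [Finset.card_erase_of_mem h.2, h.1.2, Nat.add_sub_cancel]⟩
  · rintro ⟨i, I⟩ h
    simp only [Finset.mem_sigma, Finset.mem_powersetCard, Finset.subset_erase] at h ⊢
    exact ⟨⟨Finset.insert_subset h.1 h.2.1.1, by rw [Finset.card_insert_of_notMem h.2.1.2, h.2.2]⟩,
      Finset.mem_insert_self _ _⟩
  · rintro ⟨I, i⟩ h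
    simp only [Finset.mem_sigma] at h
    simp [Finset.insert_erase h.2]
  · rintro ⟨i, I⟩ h
    simp only [Finset.mem_sigma, Finset.mem_powersetCard, Finset.subset_erase] at h
    simp [Finset.erase_insert h.2.1.2]
  · intros
    rfl

theorem sum_powerset_sum_erase (S : Finset ι) (F : ι → Finset ι → M) :
    ∑ I ∈ S.powerset, ∑ i ∈ I, F i (I.erase i)
      = ∑ i ∈ S, ∑ I ∈ (S.erase i).powerset, F i I := by
  rw [Finset.sum_sigma', Finset.sum_sigma']
  refine Finset.sum_bij' (fun p _ => ⟨p.2, p.1.erase p.2⟩) (fun p _ => ⟨insert p.1 p.2, p.1⟩)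
    ?_ ?_ ?_ ?_ ?_
  · rintro ⟨I, i⟩ h
    simp only [Finset.mem_sigma, Finset.mem_powerset] at h ⊢
    exact ⟨h.1 h.2, Finset.erase_subset_erase _ h.1⟩
  · rintro ⟨i, I⟩ h
    simp only [Finset.mem_sigma, Finset.mem_powerset, Finset.subset_erase] at h ⊢
    exact ⟨Finset.insert_subset h.1 h.2.1, Finset.mem_insert_self _ _⟩
  · rintro ⟨I, i⟩ h
    simp only [Finset.mem_sigma] at h
    simp [Finset.insert_erase h.2]
  · rintro ⟨i, I⟩ h
    simp only [Finset.mem_sigma, Finset.mem_powerset, Finset.subset_erase] at h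
    simp [Finset.erase_insert h.2.2]
  · intros
    rfl

theorem sum_powerset_sum_sdiff (S : Finset ι) (F : ι → Finset ι → M) :
    ∑ I ∈ S.powerset, ∑ i ∈ S \ I, F i I = ∑ i ∈ S, ∑ I ∈ (S.erase i).powerset, F i I := by
  refine Finset.sum_comm' fun I i => ?_
  simp only [Finset.mem_powerset, Finset.mem_sdiff, Finset.subset_erase]
  tauto

end Sums

theorem fBethe_eq_div (η x y : ℂ) :
    fBethe η (x - y)
      = (Complex.exp (-(2 * η)) * Complex.exp (2 * x) - Complex.exp (2 * η) * Complex.exp (2 * y))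
        / (Complex.exp (2 * x) - Complex.exp (2 * y)) := by
  have h : ∀ c, Complex.exp (x + y) * (2 * Complex.sinh (x - y - c))
      = Complex.exp (-c) * Complex.exp (2 * x) - Complex.exp c * Complex.exp (2 * y) := fun c => by
    rw [Complex.two_sinh, mul_sub, ← Complex.exp_add, ← Complex.exp_add, ← Complex.exp_add,
      ← Complex.exp_add]
    ring_nf
  have h0 := h 0
  simp only [sub_zero, neg_zero, Complex.exp_zero, one_mul] at h0
  rw [fBethe, ← h, ← h0, mul_div_mul_left _ _ (Complex.exp_ne_zero _),
    mul_div_mul_left _ _ two_ne_zero]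

theorem exp_two_mul_ne {x y : ℂ} (h : Complex.sinh (x - y) ≠ 0) :
    Complex.exp (2 * x) ≠ Complex.exp (2 * y) := fun he => h <| by
  have h1 : Complex.exp (x + y) * (2 * Complex.sinh (x - y)) = 0 := by
    rw [Complex.two_sinh, mul_sub, ← Complex.exp_add, ← Complex.exp_add, sub_eq_zero]
    convert he using 2 <;> ring
  simpa [Complex.exp_ne_zero] using h1

variable {ι : Type*} [DecidableEq ι]

/-- The sum over `i` of `∏ f (t_i - t_j)` is the `q`-integer of the number of terms. In the variables
`exp (2 t_i)` this is Lagrange interpolation of `∏ (q⁻¹ X - q x_j)` at the nodes `x_i` and `0`. -/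
theorem sinh_mul_sum_prod_fBethe (η : ℂ) (t : ι → ℂ) (T : Finset ι)
    (ht : ∀ i ∈ T, ∀ j ∈ T, i ≠ j → Complex.sinh (t i - t j) ≠ 0) :
    Complex.sinh (2 * η) * ∑ i ∈ T, ∏ j ∈ T.erase i, fBethe η (t i - t j)
      = Complex.sinh (2 * T.card * η) := by
  set q := Complex.exp (2 * η) with hq
  set x : ι → ℂ := fun i => Complex.exp (2 * t i) with hx
  have hq0 : q ≠ 0 := Complex.exp_ne_zero _
  have hx0 : ∀ i, x i ≠ 0 := fun i => Complex.exp_ne_zero _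
  let P : Polynomial ℂ := ∏ j ∈ T, (Polynomial.C q⁻¹ * Polynomial.X - Polynomial.C (q * x j))
  have hdeg : ∀ j, (Polynomial.C q⁻¹ * Polynomial.X - Polynomial.C (q * x j)).natDegree ≤ 1 :=
    fun j => by compute_degree
  have hP : P.degree < (Finset.insertNone T).card := by
    rw [Finset.card_insertNone, Nat.cast_add, Nat.cast_one]
    refine lt_of_le_of_lt (Polynomial.degree_prod_le _ _) (lt_of_le_of_lt
      (Finset.sum_le_card_nsmul T _ 1 fun j _ => Polynomial.natDegree_le_iff_degree_le.1 (hdeg j)) ?_)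
    rw [nsmul_one]
    exact_mod_cast Nat.lt_succ_self T.card
  have hcoeff : P.coeff T.card = q⁻¹ ^ T.card := by
    have := Polynomial.coeff_prod_of_natDegree_le T _ 1 fun j _ => hdeg j
    rw [mul_one] at this
    rw [this]
    simp [Polynomial.coeff_C_succ]
  let v : Option ι → ℂ := fun o => o.elim 0 x
  -- the node `0` is distinct from the others because these are exponentials
  have hv : Set.InjOn v (Finset.insertNone T) := by
    rintro (_ | i) hi (_ | j) hj h
    · rfl
    · exact absurd h.symm (hx0 j)
    · exact absurd h (hx0 i)
    · by_contra hij
      exact exp_two_mul_ne (ht i (by simpa using hi) j (by simpa using hj) fun h => hij (by rw [h])) h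
  have key := Lagrange.coeff_eq_sum hv hP
  have e0 : (Finset.insertNone T).erase none = T.map Function.Embedding.some := by
    ext (_ | i) <;> simp
  have e1 : ∀ i, (Finset.insertNone T).erase (some i) = Finset.insertNone (T.erase i) := fun i => by
    ext (_ | j) <;> simp
  have h0 : P.eval 0 / ∏ j ∈ T, (0 - x j) = q ^ T.card := by
    rw [Polynomial.eval_prod, ← Finset.prod_div_distrib, ← Finset.prod_const]
    refine Finset.prod_congr rfl fun j _ => ?_
    have := hx0 j
    simp
    field_simp
  have h1 : ∀ i ∈ T, P.eval (x i) / ((x i - 0) * ∏ j ∈ T.erase i, (x i - x j))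
      = (q⁻¹ - q) * ∏ j ∈ T.erase i, fBethe η (t i - t j) := fun i hi => by
    have := hx0 i
    have h2 : ∀ j, fBethe η (t i - t j) = (q⁻¹ * x i - q * x j) / (x i - x j) := fun j => by
      rw [fBethe_eq_div, Complex.exp_neg]
    simp only [h2, Finset.prod_div_distrib]
    rw [Polynomial.eval_prod, ← Finset.mul_prod_erase T _ hi]
    simp only [Polynomial.eval_sub, Polynomial.eval_mul, Polynomial.eval_C, Polynomial.eval_X]
    rw [sub_zero, ← sub_mul, mul_div_mul_comm, mul_div_assoc, div_self this, mul_one]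
  rw [Finset.card_insertNone, Nat.add_sub_cancel, hcoeff, Finset.sum_insertNone, e0,
    Finset.prod_map] at key
  simp only [e1, Finset.prod_insertNone] at key
  simp only [v, Option.elim, Function.Embedding.some_apply] at key
  rw [h0, Finset.sum_congr rfl h1, ← Finset.mul_sum] at key
  have e2 : 2 * (T.card : ℂ) * η = T.card * (2 * η) := by ring
  rw [e2, Complex.sinh, Complex.sinh, Complex.exp_neg, Complex.exp_neg, Complex.exp_nat_mul, ← hq,
    ← inv_pow]
  linear_combination (1 / 2) * key

/-- The sum over the subsets `I` of `S` of size `m` of the products `∏ f i j` over `i ∈ S \ I` and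
`j ∈ I`. -/
def crossSum (f : ι → ι → ℂ) (m : ℕ) (S : Finset ι) : ℂ :=
  ∑ I ∈ S.powersetCard m, ∏ i ∈ I, ∏ j ∈ S \ I, f j i

/-- Up to normalisation `crossSum f m S` is the `q`-binomial coefficient of `|S|` over `m`: it only
depends on the size of `S`. -/
theorem prod_sinh_mul_crossSum (η : ℂ) (f : ι → ι → ℂ) (S : Finset ι)
    (hf : ∀ T ⊆ S, Complex.sinh (2 * η) * ∑ i ∈ T, ∏ j ∈ T.erase i, f j i
      = Complex.sinh (2 * T.card * η)) (m : ℕ) :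
    (∏ k ∈ Finset.range m, Complex.sinh (2 * (k + 1 : ℕ) * η)) * crossSum f m S
      = ∏ k ∈ Finset.range m, Complex.sinh (2 * ((S.card : ℂ) - k) * η) := by
  induction m generalizing S with
  | zero => simp [crossSum]
  | succ m ih =>
    -- `|I|` in `q`-integer form is a sum over the elements of `I`, which are removed one at a time
    have h : Complex.sinh (2 * (m + 1 : ℕ) * η) * crossSum f (m + 1) S
        = Complex.sinh (2 * η) * ∑ i ∈ S, (∏ j ∈ S.erase i, f j i) * crossSum f m (S.erase i) := by
      have h1 : ∀ I ∈ S.powersetCard (m + 1),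
          Complex.sinh (2 * (m + 1 : ℕ) * η) * ∏ i ∈ I, ∏ j ∈ S \ I, f j i
            = Complex.sinh (2 * η) * ∑ i ∈ I, (∏ j ∈ S.erase i, f j i) *
              ∏ i' ∈ I.erase i, ∏ j ∈ (S.erase i) \ I.erase i, f j i' := fun I hI => by
        obtain ⟨hIS, hIm⟩ := Finset.mem_powersetCard.1 hI
        rw [← hIm, ← hf I hIS, mul_assoc, Finset.sum_mul]
        congr 1
        refine Finset.sum_congr rfl fun i hi => ?_
        have hs : (S.erase i) \ I.erase i = S \ I := by
          ext j; simp only [Finset.mem_sdiff, Finset.mem_erase]; grind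
        have hd : S.erase i = I.erase i ∪ S \ I := by
          ext j; simp only [Finset.mem_union, Finset.mem_sdiff, Finset.mem_erase]; grind
        have hdd : Disjoint (I.erase i) (S \ I) :=
          Finset.disjoint_sdiff.mono_left (Finset.erase_subset _ _)
        rw [hs, hd, Finset.prod_union hdd, ← Finset.mul_prod_erase I _ hi, mul_assoc]
      rw [crossSum, Finset.mul_sum, Finset.sum_congr rfl h1, ← Finset.mul_sum,
        sum_powersetCard_succ_sum S m fun i I => (∏ j ∈ S.erase i, f j i) *
          ∏ i' ∈ I, ∏ j ∈ (S.erase i) \ I, f j i']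
      simp only [crossSum, Finset.mul_sum]
    rw [Finset.prod_range_succ, mul_assoc, h, Finset.prod_range_succ', Nat.cast_zero, sub_zero,
      ← hf S subset_rfl, mul_left_comm, Finset.mul_sum, mul_comm (∏ _ ∈ _, _), mul_assoc,
      Finset.sum_mul]
    congr 1
    refine Finset.sum_congr rfl fun i hi => ?_
    rw [mul_left_comm, ih _ fun T hT => hf T (hT.trans (Finset.erase_subset _ _)),
      Finset.card_erase_of_mem hi]
    congr 1
    refine Finset.prod_congr rfl fun k _ => ?_
    rw [Nat.cast_sub (Finset.card_pos.2 ⟨i, hi⟩)]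
    congr 2
    push_cast
    ring

theorem crossSum_eq_zero {η : ℂ} {f : ι → ι → ℂ} {S : Finset ι} {m : ℕ}
    (hf : ∀ T ⊆ S, Complex.sinh (2 * η) * ∑ i ∈ T, ∏ j ∈ T.erase i, f j i
      = Complex.sinh (2 * T.card * η))
    (hm : 0 < m) (hne : ∀ k, 0 < k → k ≤ m → Complex.sinh (2 * k * η) ≠ 0)
    (h0 : Complex.sinh (2 * S.card * η) = 0) : crossSum f m S = 0 := by
  have h := prod_sinh_mul_crossSum η f S hf m
  rw [Finset.prod_eq_zero (i := 0) (s := Finset.range m) (f := fun k : ℕ => Complex.sinh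
    (2 * ((S.card : ℂ) - k) * η)) (Finset.mem_range.2 hm) (by rw [Nat.cast_zero, sub_zero, h0])] at h
  refine (mul_eq_zero.1 h).resolve_left (Finset.prod_ne_zero_iff.2 fun k hk => ?_)
  exact hne _ k.succ_pos (Finset.mem_range.1 hk)

/-- The sum over the subsets `I` of `S` of `∏ α i ∏ δ j ∏ f i j`, where `i` runs through `I` and `j`
through `S \ I`. -/
def removalSum (α δ : ι → ℂ) (f : ι → ι → ℂ) (S : Finset ι) : ℂ :=
  ∑ I ∈ S.powerset, (∏ i ∈ I, α i) * (∏ j ∈ S \ I, δ j) * ∏ i ∈ I, ∏ j ∈ S \ I, f i j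

theorem prod_erase_eq_mul_prod_sdiff {S I : Finset ι} (hI : I ⊆ S) {i : ι} (hi : i ∈ I)
    (g : ι → ℂ) : ∏ j ∈ S.erase i, g j = (∏ j ∈ I.erase i, g j) * ∏ j ∈ S \ I, g j := by
  have hd : S.erase i = I.erase i ∪ S \ I := by
    ext j; simp only [Finset.mem_union, Finset.mem_sdiff, Finset.mem_erase]; grind
  rw [hd, Finset.prod_union (Finset.disjoint_sdiff.mono_left (Finset.erase_subset _ _))]

/-- The recursion of the coefficients that matches `[N + 1] S^{+(N+1)} = S^{+(N)} S^{+(1)}`: the factor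
in the sum is the coefficient of the removal of one root `j`. -/
theorem removalSum_recursion (η : ℂ) (α δ : ι → ℂ) (f : ι → ι → ℂ) (S : Finset ι)
    (hf : ∀ T ⊆ S, Complex.sinh (2 * η) * ∑ i ∈ T, ∏ j ∈ T.erase i, f i j
      = Complex.sinh (2 * T.card * η))
    (hf' : ∀ T ⊆ S, Complex.sinh (2 * η) * ∑ i ∈ T, ∏ j ∈ T.erase i, f j i
      = Complex.sinh (2 * T.card * η)) (N : ℕ) (hN : S.card = N + 1) :
    Complex.sinh (2 * (N + 1 : ℕ) * η) * removalSum α δ f S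
      = Complex.sinh (2 * η) * ∑ j ∈ S, (Complex.exp (N * η) * α j * (∏ l ∈ S.erase j, f j l)
          + Complex.exp (-(N * η)) * δ j * ∏ l ∈ S.erase j, f l j) *
        removalSum (fun i => Complex.exp (-η) * α i) (fun i => Complex.exp η * δ i) f
          (S.erase j) := by
  have hE := Complex.exp_ne_zero η
  set W : Finset ι → ℂ := fun I =>
    (∏ i ∈ I, α i) * (∏ j ∈ S \ I, δ j) * ∏ i ∈ I, ∏ j ∈ S \ I, f i j with hW
  -- the part of the right-hand side in which the first removed element belongs to `I`
  have h1 : ∑ j ∈ S, Complex.exp (N * η) * α j * (∏ l ∈ S.erase j, f j l) *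
        removalSum (fun i => Complex.exp (-η) * α i) (fun i => Complex.exp η * δ i) f (S.erase j)
      = ∑ I ∈ S.powerset, W I * Complex.exp (2 * (S \ I).card * η) *
          ∑ j ∈ I, ∏ l ∈ I.erase j, f j l := by
    simp only [removalSum, Finset.mul_sum]
    rw [← sum_powerset_sum_erase S fun j I => Complex.exp (N * η) * α j *
      (∏ l ∈ S.erase j, f j l) * ((∏ i ∈ I, Complex.exp (-η) * α i) *
        (∏ i ∈ S.erase j \ I, Complex.exp η * δ i) * ∏ i ∈ I, ∏ l ∈ S.erase j \ I, f i l)]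
    refine Finset.sum_congr rfl fun I hI => Finset.sum_congr rfl fun j hj => ?_
    rw [Finset.mem_powerset] at hI
    have hs : S.erase j \ I.erase j = S \ I := by
      ext l; simp only [Finset.mem_sdiff, Finset.mem_erase]; grind
    have hc : S.card = (I.erase j).card + 1 + (S \ I).card := by
      rw [Finset.card_erase_add_one hj, add_comm, Finset.card_sdiff_add_card_eq_card hI]
    have hN' : N = (I.erase j).card + (S \ I).card := by omega
    rw [hs, prod_erase_eq_mul_prod_sdiff hI hj, hW]
    simp only [Finset.prod_mul_distrib, Finset.prod_const]
    rw [← Finset.mul_prod_erase I α hj, ← Finset.mul_prod_erase I _ hj, hN', Nat.cast_add, add_mul,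
      mul_assoc 2, two_mul, Complex.exp_add, Complex.exp_add, Complex.exp_nat_mul,
      Complex.exp_nat_mul, Complex.exp_neg, inv_pow]
    field_simp
  -- the part in which it does not
  have h2 : ∑ j ∈ S, Complex.exp (-(N * η)) * δ j * (∏ l ∈ S.erase j, f l j) *
        removalSum (fun i => Complex.exp (-η) * α i) (fun i => Complex.exp η * δ i) f (S.erase j)
      = ∑ I ∈ S.powerset, W I * Complex.exp (-(2 * I.card * η)) *
          ∑ j ∈ S \ I, ∏ l ∈ (S \ I).erase j, f l j := by
    simp only [removalSum, Finset.mul_sum]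
    rw [← sum_powerset_sum_sdiff S fun j I => Complex.exp (-(N * η)) * δ j *
      (∏ l ∈ S.erase j, f l j) * ((∏ i ∈ I, Complex.exp (-η) * α i) *
        (∏ i ∈ S.erase j \ I, Complex.exp η * δ i) * ∏ i ∈ I, ∏ l ∈ S.erase j \ I, f i l)]
    refine Finset.sum_congr rfl fun I hI => Finset.sum_congr rfl fun j hj => ?_
    rw [Finset.mem_powerset] at hI
    have hs : S.erase j \ I = (S \ I).erase j := by
      ext l; simp only [Finset.mem_sdiff, Finset.mem_erase]; grind
    have hc : S.card = I.card + (((S \ I).erase j).card + 1) := by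
      rw [Finset.card_erase_add_one hj, add_comm, Finset.card_sdiff_add_card_eq_card hI]
    have hN' : N = I.card + ((S \ I).erase j).card := by omega
    rw [hs, prod_erase_eq_mul_prod_sdiff Finset.sdiff_subset hj, Finset.sdiff_sdiff_eq_self hI, hW]
    simp only [Finset.prod_mul_distrib, Finset.prod_const]
    rw [← Finset.mul_prod_erase (S \ I) δ hj,
      Finset.prod_congr (g := fun i => f i j * ∏ l ∈ (S \ I).erase j, f i l) rfl
        fun i _ => (Finset.mul_prod_erase (S \ I) (f i) hj).symm, Finset.prod_mul_distrib,
      hN', Nat.cast_add, add_mul, mul_assoc 2, two_mul, Complex.exp_neg, Complex.exp_neg,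
      Complex.exp_neg, Complex.exp_add, Complex.exp_add, Complex.exp_nat_mul, Complex.exp_nat_mul,
      inv_pow]
    field_simp
  simp only [add_mul, Finset.sum_add_distrib]
  rw [h1, h2, removalSum, ← Finset.sum_add_distrib, Finset.mul_sum, Finset.mul_sum]
  refine Finset.sum_congr rfl fun I hI => ?_
  rw [Finset.mem_powerset] at hI
  have e1 := hf I hI
  have e2 := hf' (S \ I) Finset.sdiff_subset
  have hc : (N + 1 : ℕ) = (I.card : ℂ) + (S \ I).card := by
    rw [← hN, ← Finset.card_sdiff_add_card_eq_card hI]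
    push_cast
    ring
  have hsinh : ∀ a b : ℂ, Complex.sinh (a + b)
      = Complex.exp b * Complex.sinh a + Complex.exp (-a) * Complex.sinh b := fun a b => by
    simp only [Complex.sinh, neg_add, Complex.exp_add]
    ring
  rw [hc, mul_add, add_mul, hsinh]
  linear_combination (-W I * Complex.exp (2 * (S \ I).card * η)) * e1
    - W I * Complex.exp (-(2 * I.card * η)) * e2

/-- On the solutions of the Bethe equations only the empty and the full subset contribute when
`q ^ (2 |S|) = 1`. -/
theorem removalSum_eq_zero {η ρ : ℂ} {α δ : ι → ℂ} {f : ι → ι → ℂ} {S : Finset ι}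
    (hS : S.Nonempty)
    (hf : ∀ T ⊆ S, Complex.sinh (2 * η) * ∑ i ∈ T, ∏ j ∈ T.erase i, f j i
      = Complex.sinh (2 * T.card * η))
    (hf0 : ∀ i ∈ S, ∀ j ∈ S, i ≠ j → f i j ≠ 0)
    (hb : ∀ i ∈ S, α i * ∏ j ∈ S.erase i, f i j = δ i * ∏ j ∈ S.erase i, f j i)
    (hne : ∀ k, 0 < k → k < S.card → Complex.sinh (2 * k * η) ≠ 0)
    (h0 : Complex.sinh (2 * S.card * η) = 0)
    (hroot : ρ⁻¹ ^ S.card + (-ρ) ^ S.card = 0) :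
    removalSum (fun i => ρ⁻¹ * α i) (fun i => -ρ * δ i) f S = 0 := by
  -- multiplying the Bethe equations over `I`, the factors `f` within `I` cancel
  have key : ∀ I ⊆ S, (∏ i ∈ I, α i) * ∏ i ∈ I, ∏ j ∈ S \ I, f i j
      = (∏ i ∈ I, δ i) * ∏ i ∈ I, ∏ j ∈ S \ I, f j i := fun I hI => by
    have hG : ∏ i ∈ I, ∏ j ∈ I.erase i, f i j ≠ 0 :=
      Finset.prod_ne_zero_iff.2 fun i hi => Finset.prod_ne_zero_iff.2 fun j hj =>
        hf0 i (hI hi) j (hI (Finset.mem_of_mem_erase hj)) (Finset.ne_of_mem_erase hj).symm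
    have hG' : ∏ i ∈ I, ∏ j ∈ I.erase i, f j i = ∏ i ∈ I, ∏ j ∈ I.erase i, f i j :=
      Finset.prod_comm' fun i j => by simp only [Finset.mem_erase]; tauto
    have h := Finset.prod_congr (s₁ := I) rfl fun i hi => hb i (hI hi)
    simp only [Finset.prod_mul_distrib] at h
    rw [Finset.prod_congr rfl fun i hi => prod_erase_eq_mul_prod_sdiff hI hi (f i),
      Finset.prod_congr rfl fun i hi => prod_erase_eq_mul_prod_sdiff hI hi fun j => f j i,
      Finset.prod_mul_distrib, Finset.prod_mul_distrib, hG'] at h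
    exact mul_left_cancel₀ hG (by linear_combination h)
  have hterm : ∀ m, ∑ I ∈ S.powersetCard m, (∏ i ∈ I, ρ⁻¹ * α i) * (∏ j ∈ S \ I, -ρ * δ j) *
      ∏ i ∈ I, ∏ j ∈ S \ I, f i j
      = ρ⁻¹ ^ m * (-ρ) ^ (S.card - m) * (∏ i ∈ S, δ i) * crossSum f m S := fun m => by
    rw [crossSum, Finset.mul_sum]
    refine Finset.sum_congr rfl fun I hI => ?_
    obtain ⟨hIS, rfl⟩ := Finset.mem_powersetCard.1 hI
    rw [← Finset.prod_sdiff hIS]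
    simp only [Finset.prod_mul_distrib, Finset.prod_const, Finset.card_sdiff_of_subset hIS]
    linear_combination ρ⁻¹ ^ I.card * (-ρ) ^ (S.card - I.card) * (∏ j ∈ S \ I, δ j) * key I hIS
  obtain ⟨n, hn⟩ := Nat.exists_eq_succ_of_ne_zero (Finset.card_pos.2 hS).ne'
  rw [removalSum, Finset.sum_powerset, Finset.sum_congr rfl fun m _ => hterm m,
    Finset.sum_range_succ, hn, Finset.sum_range_succ', Finset.sum_eq_zero, ← hn]
  · simp only [crossSum, Finset.powersetCard_zero, Finset.powersetCard_self, Finset.sum_singleton,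
      Finset.prod_empty, Finset.sdiff_self, Finset.prod_const_one]
    simp only [pow_zero, Nat.sub_zero, Nat.sub_self]
    linear_combination (∏ i ∈ S, δ i) * hroot
  · intro m hm
    rw [Finset.mem_range] at hm
    rw [crossSum_eq_zero hf m.succ_pos (fun k hk hkm => hne k hk (by omega)) h0, mul_zero]

/-! ### Operators acting on off-shell Bethe vectors -/

section BetheAction

variable {ι V : Type*} [DecidableEq ι] [AddCommGroup V] [Module ℂ V]

/-- The action on Bethe vectors of a family of operators with commutation relations of the type of
those of `A` or `D` with `B`. -/
theorem action_on_bethe_vector {X B : ι → Module.End ℂ V} {Ψ : Finset ι → V} {φ γ : ι → ι → ℂ}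
    {x : ι → ℂ} (hΨ : ∀ j Y, j ∉ Y → Ψ (insert j Y) = B j (Ψ Y))
    (hX : ∀ j k, j ≠ k → X j * B k = φ j k • (B k * X j) + γ j k • (B j * X k))
    (h0 : ∀ j, X j (Ψ ∅) = x j • Ψ ∅)
    (h3 : ∀ j k l, j ≠ k → k ≠ l → j ≠ l →
      φ j k * γ j l + γ j k * γ k l = γ j l * φ l k)
    (Y : Finset ι) {j : ι} (hj : j ∉ Y) :
    X j (Ψ Y) = (x j * ∏ l ∈ Y, φ j l) • Ψ Y
      + ∑ k ∈ Y, (γ j k * (x k * ∏ l ∈ Y.erase k, φ k l)) • Ψ (insert j (Y.erase k)) := by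
  induction Y using Finset.induction_on generalizing j with
  | empty => simp [h0]
  | insert m Y hm ih =>
    rw [Finset.mem_insert, not_or] at hj
    have hXB : X j (B m (Ψ Y)) = φ j m • B m (X j (Ψ Y)) + γ j m • B j (X m (Ψ Y)) := by
      have := congrArg (fun T : Module.End ℂ V => T (Ψ Y)) (hX j m hj.1)
      simpa using this
    rw [hΨ m Y hm, hXB, ih hj.2, ih hm, Finset.prod_insert hm, Finset.sum_insert hm,
      Finset.erase_insert hm, ← hΨ m Y hm]
    have h1 : ∀ k ∈ Y, (γ j k * (x k * ∏ l ∈ (insert m Y).erase k, φ k l)) •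
          Ψ (insert j ((insert m Y).erase k))
        = φ j m • ((γ j k * (x k * ∏ l ∈ Y.erase k, φ k l)) • B m (Ψ (insert j (Y.erase k))))
          + γ j m • ((γ m k * (x k * ∏ l ∈ Y.erase k, φ k l)) • B j (Ψ (insert m (Y.erase k)))) := by
      intro k hk
      have hmk : m ≠ k := fun h => hm (h ▸ hk)
      have hjk : j ≠ k := fun h => hj.2 (h ▸ hk)
      have hmY : m ∉ Y.erase k := fun h => hm (Finset.mem_of_mem_erase h)
      have hjY : j ∉ Y.erase k := fun h => hj.2 (Finset.mem_of_mem_erase h)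
      rw [← hΨ m _ (by simp [Ne.symm hj.1, hm]), ← hΨ j _ (by simp [hj.1, hj.2]), Finset.insert_comm m j,
        Finset.erase_insert_of_ne hmk, Finset.prod_insert hmY, smul_smul, smul_smul, ← add_smul]
      congr 1
      linear_combination (-(x k * ∏ l ∈ Y.erase k, φ k l)) * h3 j m k hj.1 hmk hjk
    rw [Finset.sum_congr rfl h1]
    simp only [map_add, map_sum, map_smul, smul_add, Finset.smul_sum, Finset.sum_add_distrib,
      ← hΨ m Y hm, ← hΨ j Y hj.2]
    module

/-- The action on Bethe vectors of an operator whose commutators with the `B j` are combinations of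
`A j` and `D j`: each term removes one of the roots. -/
theorem lowering_on_bethe_vector {A B D : ι → Module.End ℂ V} {s : Module.End ℂ V}
    {Ψ : Finset ι → V} {f g : ι → ι → ℂ} {a d e : ι → ℂ} {u v : ℕ → ℂ}
    (hΨ : ∀ j Y, j ∉ Y → Ψ (insert j Y) = B j (Ψ Y))
    (hA : ∀ Y j, j ∉ Y → A j (Ψ Y) = (a j * ∏ l ∈ Y, f j l) • Ψ Y
      + ∑ k ∈ Y, (g j k * (a k * ∏ l ∈ Y.erase k, f k l)) • Ψ (insert j (Y.erase k)))
    (hD : ∀ Y j, j ∉ Y → D j (Ψ Y) = (d j * ∏ l ∈ Y, f l j) • Ψ Y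
      + ∑ k ∈ Y, (-g j k * (d k * ∏ l ∈ Y.erase k, f l k)) • Ψ (insert j (Y.erase k)))
    (hs0 : s (Ψ ∅) = 0)
    (hs : ∀ j Y, j ∉ Y → s (B j (Ψ Y)) = B j (s (Ψ Y))
      + (e j * u Y.card) • A j (Ψ Y) - (e j * v Y.card) • D j (Ψ Y))
    (hu : ∀ j k r, j ≠ k → e k * u r + e j * u (r + 1) * g j k = e k * u (r + 1) * f k j)
    (hv : ∀ j k r, j ≠ k → e k * v r - e j * v (r + 1) * g j k = e k * v (r + 1) * f j k)
    (Y : Finset ι) :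
    s (Ψ Y) = ∑ k ∈ Y, (e k * (u (Y.card - 1) * (a k * ∏ l ∈ Y.erase k, f k l)
      - v (Y.card - 1) * (d k * ∏ l ∈ Y.erase k, f l k))) • Ψ (Y.erase k) := by
  induction Y using Finset.induction_on with
  | empty => simp [hs0]
  | insert m Y hm ih =>
    rw [hΨ m Y hm, hs m Y hm, ih, hA Y m hm, hD Y m hm, Finset.sum_insert hm,
      Finset.erase_insert hm, Finset.card_insert_of_notMem hm, Nat.add_sub_cancel]
    have h1 : ∀ k ∈ Y, (e k * (u Y.card * (a k * ∏ l ∈ (insert m Y).erase k, f k l)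
          - v Y.card * (d k * ∏ l ∈ (insert m Y).erase k, f l k))) • Ψ ((insert m Y).erase k)
        = (e k * (u (Y.card - 1) * (a k * ∏ l ∈ Y.erase k, f k l)
            - v (Y.card - 1) * (d k * ∏ l ∈ Y.erase k, f l k))) • B m (Ψ (Y.erase k))
          + (e m * u Y.card) • ((g m k * (a k * ∏ l ∈ Y.erase k, f k l)) •
              Ψ (insert m (Y.erase k)))
          - (e m * v Y.card) • ((-g m k * (d k * ∏ l ∈ Y.erase k, f l k)) •
              Ψ (insert m (Y.erase k))) := by
      intro k hk
      have hmk : m ≠ k := fun h => hm (h ▸ hk)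
      have hmY : m ∉ Y.erase k := fun h => hm (Finset.mem_of_mem_erase h)
      obtain ⟨r, hr⟩ : ∃ r, Y.card = r + 1 :=
        Nat.exists_eq_succ_of_ne_zero (Finset.card_pos.2 ⟨k, hk⟩).ne'
      rw [← hΨ m _ hmY, Finset.erase_insert_of_ne hmk, Finset.prod_insert hmY,
        Finset.prod_insert hmY, smul_smul, smul_smul, ← add_smul, ← sub_smul, hr,
        Nat.add_sub_cancel]
      congr 1
      linear_combination (-(a k * ∏ l ∈ Y.erase k, f k l)) * hu m k r hmk
        + (d k * ∏ l ∈ Y.erase k, f l k) * hv m k r hmk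
    rw [Finset.sum_congr rfl h1]
    simp only [map_sum, map_smul, smul_add, Finset.smul_sum, Finset.sum_add_distrib,
      Finset.sum_sub_distrib]
    module

/-- The action of the divided powers on Bethe vectors, as a sum over the sets of removed roots, when
`q` is generic. Each divided power is obtained from the previous one by `removalSum_recursion`. -/
theorem dividedPower_on_bethe_vector {η c : ℂ} {σ : ℕ → Module.End ℂ V} {Ψ : Finset ι → V}
    {f : ι → ι → ℂ} {a d e : ι → ℂ}
    (hσ0 : σ 0 = 1)
    (hσ : ∀ n, Complex.sinh (2 * η) • (σ n * σ 1)
      = Complex.sinh (2 * (n + 1 : ℕ) * η) • σ (n + 1))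
    (hf : ∀ T : Finset ι, Complex.sinh (2 * η) * ∑ i ∈ T, ∏ j ∈ T.erase i, f i j
      = Complex.sinh (2 * T.card * η))
    (hf' : ∀ T : Finset ι, Complex.sinh (2 * η) * ∑ i ∈ T, ∏ j ∈ T.erase i, f j i
      = Complex.sinh (2 * T.card * η))
    (h1 : ∀ Y : Finset ι, σ 1 (Ψ Y) = ∑ k ∈ Y,
      (e k * (Complex.exp (-((c - 2 * (Y.card - 1 : ℕ)) * η)) * (a k * ∏ l ∈ Y.erase k, f k l)
      - Complex.exp ((c - 2 * (Y.card - 1 : ℕ)) * η) * (d k * ∏ l ∈ Y.erase k, f l k))) •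
        Ψ (Y.erase k))
    (N : ℕ) (hN : ∀ k, 0 < k → k ≤ N → Complex.sinh (2 * k * η) ≠ 0) (Y : Finset ι) :
    σ N (Ψ Y) = ∑ S ∈ Y.powersetCard N, removalSum
      (fun i => (Complex.exp ((c - 2 * Y.card + N + 1) * η))⁻¹ *
        (e i * (a i * ∏ l ∈ Y \ S, f i l)))
      (fun i => -Complex.exp ((c - 2 * Y.card + N + 1) * η) *
        (e i * (d i * ∏ l ∈ Y \ S, f l i))) f S • Ψ (Y \ S) := by
  induction N generalizing Y with
  | zero => simp [hσ0, removalSum]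
  | succ N ih =>
    apply smul_right_injective V (hN (N + 1) N.succ_pos le_rfl)
    have hσ' : Complex.sinh (2 * (N + 1 : ℕ) * η) • σ (N + 1) (Ψ Y)
        = Complex.sinh (2 * η) • σ N (σ 1 (Ψ Y)) := by
      have := congrArg (fun T : Module.End ℂ V => T (Ψ Y)) (hσ N)
      simpa using this.symm
    simp only
    rw [hσ', h1, map_sum]
    simp only [map_smul, ih fun k hk hkN => hN k hk (hkN.trans N.le_succ), Finset.smul_sum]
    rw [← sum_powersetCard_succ_sum Y N fun k S => Complex.sinh (2 * η) •
      (e k * (Complex.exp (-((c - 2 * (Y.card - 1 : ℕ)) * η)) * (a k * ∏ l ∈ Y.erase k, f k l)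
        - Complex.exp ((c - 2 * (Y.card - 1 : ℕ)) * η) * (d k * ∏ l ∈ Y.erase k, f l k))) •
      removalSum (fun i => (Complex.exp ((c - 2 * (Y.erase k).card + N + 1) * η))⁻¹ *
        (e i * (a i * ∏ l ∈ Y.erase k \ S, f i l)))
      (fun i => -Complex.exp ((c - 2 * (Y.erase k).card + N + 1) * η) *
        (e i * (d i * ∏ l ∈ Y.erase k \ S, f l i))) f S • Ψ (Y.erase k \ S)]
    refine Finset.sum_congr rfl fun S hS => ?_
    obtain ⟨hSY, hSN⟩ := Finset.mem_powersetCard.1 hS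
    rw [smul_smul, removalSum_recursion η _ _ f S (fun T _ => hf T) (fun T _ => hf' T) N hSN,
      Finset.mul_sum, Finset.sum_smul]
    refine Finset.sum_congr rfl fun k hk => ?_
    have hs : Y.erase k \ S.erase k = Y \ S := by
      ext l; simp only [Finset.mem_sdiff, Finset.mem_erase]; grind
    obtain ⟨r, hr⟩ : ∃ r, Y.card = r + 1 :=
      Nat.exists_eq_succ_of_ne_zero (Finset.card_pos.2 ⟨k, hSY hk⟩).ne'
    rw [hs, smul_smul, smul_smul, Finset.card_erase_of_mem (hSY hk), hr, Nat.add_sub_cancel,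
      prod_erase_eq_mul_prod_sdiff hSY hk (f k),
      prod_erase_eq_mul_prod_sdiff hSY hk fun l => f l k]
    have e1 : ∀ i, (Complex.exp ((c - 2 * r + N + 1) * η))⁻¹ * (e i * (a i * ∏ l ∈ Y \ S, f i l))
        = Complex.exp (-η) * ((Complex.exp ((c - 2 * (r + 1 : ℕ) + (N + 1 : ℕ) + 1) * η))⁻¹ *
          (e i * (a i * ∏ l ∈ Y \ S, f i l))) := fun i => by
      rw [← mul_assoc (Complex.exp _), ← Complex.exp_neg, ← Complex.exp_neg, ← Complex.exp_add]
      congr 2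
      push_cast
      ring
    have e2 : ∀ i, -Complex.exp ((c - 2 * r + N + 1) * η) * (e i * (d i * ∏ l ∈ Y \ S, f l i))
        = Complex.exp η * (-Complex.exp ((c - 2 * (r + 1 : ℕ) + (N + 1 : ℕ) + 1) * η) *
          (e i * (d i * ∏ l ∈ Y \ S, f l i))) := fun i => by
      rw [← mul_assoc (Complex.exp _), mul_neg, ← Complex.exp_add]
      congr 3
      push_cast
      ring
    have e3 : Complex.exp (-((c - 2 * r) * η)) = Complex.exp (N * η) *
        (Complex.exp ((c - 2 * (r + 1 : ℕ) + (N + 1 : ℕ) + 1) * η))⁻¹ := by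
      rw [← Complex.exp_neg, ← Complex.exp_add]
      congr 1
      push_cast
      ring
    have e4 : Complex.exp ((c - 2 * r) * η) = Complex.exp (-(N * η)) *
        Complex.exp ((c - 2 * (r + 1 : ℕ) + (N + 1 : ℕ) + 1) * η) := by
      rw [← Complex.exp_add]
      congr 1
      push_cast
      ring
    simp only [e1, e2]
    rw [e3, e4]
    congr 1
    ring

end BetheAction

/-! ### Commutation relations and vacuum eigenvalues of the monodromy matrix -/

section Relations

variable {L : ℕ} (η : ℂ) (ξ : Fin L → ℂ)

theorem opB_commute {z w : ℂ} (h : Complex.sinh (z - w + 2 * η) ≠ 0) :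
    Commute (opB η ξ z) (opB η ξ w) := by
  have := monodromy_rtt η ξ z w 0 0 1 1
  simp [rMatrix, Fin.sum_univ_two] at this
  exact smul_right_injective _ h this

theorem opA_mul_opB {z w : ℂ} (h : Complex.sinh (z - w) ≠ 0) :
    monodromy η ξ z 0 0 * opB η ξ w = fBethe η (z - w) • (opB η ξ w * monodromy η ξ z 0 0)
      + (Complex.sinh (2 * η) / Complex.sinh (z - w)) •
        (opB η ξ z * monodromy η ξ w 0 0) := by
  have := monodromy_rtt η ξ w z 0 0 1 0
  simp [rMatrix, Fin.sum_univ_two] at this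
  have h1 : Complex.sinh (w - z) = -Complex.sinh (z - w) := by rw [← Complex.sinh_neg, neg_sub]
  have h2 : Complex.sinh (w - z + 2 * η) = -Complex.sinh (z - w - 2 * η) := by
    rw [← Complex.sinh_neg]; ring_nf
  rw [h1, h2] at this
  rw [fBethe, opB, opB]
  linear_combination (norm := (match_scalars <;> field_simp <;> ring))
    (Complex.sinh (z - w))⁻¹ • this

theorem opD_mul_opB {z w : ℂ} (h : Complex.sinh (z - w) ≠ 0) :
    monodromy η ξ z 1 1 * opB η ξ w = fBethe η (w - z) • (opB η ξ w * monodromy η ξ z 1 1)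
      + (-(Complex.sinh (2 * η) / Complex.sinh (z - w))) •
        (opB η ξ z * monodromy η ξ w 1 1) := by
  have := monodromy_rtt η ξ z w 1 0 1 1
  simp [rMatrix, Fin.sum_univ_two] at this
  have h1 : Complex.sinh (w - z) = -Complex.sinh (z - w) := by rw [← Complex.sinh_neg, neg_sub]
  have h2 : Complex.sinh (w - z - 2 * η) = -Complex.sinh (z - w + 2 * η) := by
    rw [← Complex.sinh_neg]; ring_nf
  rw [fBethe, opB, opB, h1, h2]
  linear_combination (norm := (match_scalars <;> field_simp <;> ring))
    (Complex.sinh (z - w))⁻¹ • this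

theorem monodromy_vacuum {L : ℕ} (η : ℂ) (ξ : Fin L → ℂ) (z : ℂ) :
    monodromy η ξ z 0 0 *ᵥ vacuum L = aVac η ξ z • vacuum L ∧
    monodromy η ξ z 1 1 *ᵥ vacuum L = dVac η ξ z • vacuum L ∧
    monodromy η ξ z 1 0 *ᵥ vacuum L = 0 := by
  induction L with
  | zero => simp [monodromy, aVac, dVac]
  | succ L ih =>
    obtain ⟨hA, hD, hC⟩ := ih fun n => ξ n.castSucc
    have hv : ∀ (X : SpinOp L) (s : Config L), (X *ᵥ vacuum L) s = X s fun _ => 0 := fun X s => by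
      simp [vacuum]
    have hv' : ∀ (X : SpinOp (L + 1)) (s : Config L) (i : Fin 2),
        (X *ᵥ vacuum (L + 1)) (Fin.snoc s i : Config (L + 1))
          = (lastBlocks X i 0 *ᵥ vacuum L) s := fun X s i => by
      rw [hv, lastBlocks_apply]
      simp only [vacuum, mulVec_single, MulOpposite.op_one, one_smul]
      congr 1
      funext n
      refine Fin.lastCases ?_ (fun m => ?_) n <;> simp
    have hv0 : ∀ (s : Config L) (i : Fin 2), vacuum (L + 1) (Fin.snoc s i : Config (L + 1))
        = if i = 0 then vacuum L s else 0 := fun s i => by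
      have := hv' 1 s i
      rw [one_mulVec, map_one] at this
      rw [this]
      clear this
      revert i
      simp [Fin.forall_fin_two]
    refine ⟨?_, ?_, ?_⟩ <;>
    · funext s
      obtain ⟨s, i, rfl⟩ : ∃ (s' : Config L) (i : Fin 2), s = Fin.snoc s' i :=
        ⟨Fin.init s, s (Fin.last L), (Fin.snoc_init_self s).symm⟩
      rw [hv']
      simp only [Pi.smul_apply, hv0, lastBlocks_monodromy_zero, lastBlocks_monodromy_one]
      fin_cases i <;> simp [smul_mulVec, hA, hD, hC, aVac, dVac, Fin.prod_univ_castSucc] <;> ring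

theorem SPlusXi_vacuum {N : ℕ} (hN : N ≠ 0) : SPlusXi N η ξ *ᵥ vacuum L = 0 := by
  rw [SPlusXi_eq_sum, sum_mulVec]
  refine Finset.sum_eq_zero fun J hJ => ?_
  obtain ⟨i, hi⟩ : J.Nonempty := by
    rw [← Finset.card_ne_zero, (Finset.mem_powersetCard.1 hJ).2]; exact hN
  funext s
  simp only [vacuum, mulVec_single, MulOpposite.op_one, one_smul, col_apply, sTerm, siteTensor,
    of_apply, Pi.zero_apply]
  refine Finset.prod_eq_zero (Finset.mem_univ i) ?_
  rw [if_pos hi]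
  generalize s i = k
  fin_cases k <;> simp [sigmaPlus]

theorem expSpin_vacuum (c : ℂ) : expSpin L c *ᵥ vacuum L = Complex.exp (L * c) • vacuum L := by
  funext s
  simp only [vacuum, mulVec_single, MulOpposite.op_one, one_smul, col_apply, expSpin, siteTensor,
    of_apply, Pi.smul_apply, smul_eq_mul]
  by_cases hs : s = fun _ => 0
  · subst hs
    simp [expSigmaZ, Complex.exp_nat_mul]
  · obtain ⟨i, hi⟩ := Function.ne_iff.1 hs
    rw [Pi.single_eq_of_ne hs, mul_zero]
    refine Finset.prod_eq_zero (Finset.mem_univ i) ?_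
    have h1 : s i = 1 := by omega
    simp [h1, expSigmaZ]

end Relations

/-! ### Divided powers on off-shell Bethe vectors at generic `q` -/

/-- The Bethe vector of a subset of the roots. The operators `B` are applied in the order of the
indices, as they are only known to commute under a genericity condition on `t` and `η`. -/
def partialBetheVector {L R : ℕ} (η : ℂ) (ξ : Fin L → ℂ) (t : Fin R → ℂ) (Y : Finset (Fin R)) :
    SpinVec L :=
  ((Y.sort (· ≤ ·)).map fun j => opB η ξ (t j)).prod *ᵥ vacuum L

theorem partialBetheVector_univ {L R : ℕ} (η : ℂ) (ξ : Fin L → ℂ) (t : Fin R → ℂ) :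
    partialBetheVector η ξ t Finset.univ = betheVector η ξ t := by
  rw [partialBetheVector, betheVector, Fin.sort_univ, List.ofFn_eq_map]

/-- The coefficient of the Bethe vector of the roots outside `S` in the action of `S_ξ^{+(|S|)}`. -/
def removalCoeff {L R : ℕ} (η : ℂ) (ξ : Fin L → ℂ) (t : Fin R → ℂ) (S : Finset (Fin R)) : ℂ :=
  removalSum
    (fun i => (Complex.exp ((L - 2 * R + S.card + 1) * η))⁻¹ *
      (Complex.exp (t i) * (aVac η ξ (t i) * ∏ l ∈ Finset.univ \ S, fBethe η (t i - t l))))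
    (fun i => -Complex.exp ((L - 2 * R + S.card + 1) * η) *
      (Complex.exp (t i) * (dVac η ξ (t i) * ∏ l ∈ Finset.univ \ S, fBethe η (t l - t i))))
    (fun i j => fBethe η (t i - t j)) S

/-- The identity that makes the unwanted terms in the action of `A` on Bethe vectors combine. -/
theorem three_term_sinh {η x y z : ℂ} (h1 : Complex.sinh (x - y) ≠ 0)
    (h2 : Complex.sinh (y - z) ≠ 0) (h3 : Complex.sinh (x - z) ≠ 0) :
    fBethe η (x - y) * (Complex.sinh (2 * η) / Complex.sinh (x - z))
      + Complex.sinh (2 * η) / Complex.sinh (x - y) * (Complex.sinh (2 * η) / Complex.sinh (y - z))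
      = Complex.sinh (2 * η) / Complex.sinh (x - z) * fBethe η (z - y) := by
  obtain ⟨u, rfl⟩ : ∃ u, x = u + y := ⟨x - y, by ring⟩
  obtain ⟨w, rfl⟩ : ∃ w, y = w + z := ⟨y - z, by ring⟩
  have e1 : u + (w + z) - (w + z) = u := by ring
  have e2 : u + (w + z) - z = u + w := by ring
  have e3 : w + z - z = w := by ring
  have e4 : z - (w + z) = -w := by ring
  have e5 : -w - 2 * η = -(w + 2 * η) := by ring
  rw [e1] at h1
  rw [e3] at h2
  rw [e2] at h3
  rw [e1, e2, e3, e4, fBethe, fBethe, e5, Complex.sinh_neg, Complex.sinh_neg]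
  field_simp
  simp only [Complex.sinh_add, Complex.sinh_sub]
  ring

/-- The identities that make the terms in `A` and in `D` of the commutator of `S_ξ^{+(1)}` with a new
`B` combine with the previous coefficients. -/
theorem exp_mul_fBethe {x y : ℂ} (h : Complex.sinh (x - y) ≠ 0) (η : ℂ) :
    Complex.exp y * Complex.exp (-(2 * η))
        + Complex.exp x * (Complex.sinh (2 * η) / Complex.sinh (x - y))
      = Complex.exp y * fBethe η (y - x) ∧
    Complex.exp y * Complex.exp (2 * η)
        - Complex.exp x * (Complex.sinh (2 * η) / Complex.sinh (x - y))
      = Complex.exp y * fBethe η (x - y) := by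
  obtain ⟨u, rfl⟩ : ∃ u, x = u + y := ⟨x - y, by ring⟩
  have e1 : y - (u + y) = -u := by ring
  have e2 : -u - 2 * η = -(u + 2 * η) := by ring
  rw [add_sub_cancel_right] at h
  rw [add_sub_cancel_right, e1, fBethe, fBethe, e2, Complex.sinh_neg, Complex.sinh_neg]
  have hu := Complex.exp_ne_zero u
  have hη := Complex.exp_ne_zero (2 * η)
  constructor <;>
  · field_simp
    simp only [Complex.sinh, sub_eq_add_neg, neg_add, neg_neg, Complex.exp_add, Complex.exp_neg]
    field_simp
    ring

theorem SPlusXi_mulVec_betheVector_of_generic {L R : ℕ} {η : ℂ} (ξ : Fin L → ℂ) {t : Fin R → ℂ}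
    (ht : ∀ j k, j ≠ k → Complex.sinh (t j - t k) ≠ 0)
    (htη : ∀ j k, j ≠ k → Complex.sinh (t j - t k + 2 * η) ≠ 0)
    {N : ℕ} (hN : ∀ k, 0 < k → k ≤ N → Complex.sinh (2 * k * η) ≠ 0) :
    SPlusXi N η ξ *ᵥ betheVector η ξ t = ∑ S ∈ Finset.univ.powersetCard N,
      removalCoeff η ξ t S • partialBetheVector η ξ t (Finset.univ \ S) := by
  set Ψ := partialBetheVector η ξ t with hΨdef
  have hcomm : ∀ j k, Commute (opB η ξ (t j)) (opB η ξ (t k)) := fun j k => by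
    by_cases hjk : j = k
    · rw [hjk]
    · exact opB_commute η ξ (htη j k hjk)
  have hΨ : ∀ j Y, j ∉ Y → Ψ (insert j Y) = toLinAlgEquiv' (opB η ξ (t j)) (Ψ Y) :=
    fun j Y hj => by
      have hp : ((insert j Y).sort (· ≤ ·)).Perm (j :: Y.sort (· ≤ ·)) := by
        rw [← Multiset.coe_eq_coe, Finset.sort_eq, ← Multiset.cons_coe, Finset.sort_eq,
          Finset.insert_val_of_notMem hj]
      rw [toLinAlgEquiv'_apply, hΨdef, partialBetheVector, partialBetheVector, mulVec_mulVec,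
        (hp.map _).prod_eq' (List.pairwise_map.2 (List.pairwise_of_forall fun j k => hcomm j k)),
        List.map_cons, List.prod_cons]
  have hΨ0 : Ψ ∅ = vacuum L := by simp [hΨdef, partialBetheVector]
  have hK : ∀ c Y, expSpin L c *ᵥ Ψ Y
      = Complex.exp ((L - 2 * (Y.card : ℂ)) * c) • Ψ Y := fun c Y => by
    induction Y using Finset.induction_on with
    | empty => simp [hΨ0, expSpin_vacuum]
    | insert m Y hm ih =>
      rw [hΨ m Y hm, toLinAlgEquiv'_apply, mulVec_mulVec, opB,
        (expSpin_mul_monodromy η c ξ (t m)).2.1, smul_mulVec, ← mulVec_mulVec, ih, mulVec_smul,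
        smul_smul, ← Complex.exp_add, Finset.card_insert_of_notMem hm]
      congr 2
      push_cast
      ring
  set f : Fin R → Fin R → ℂ := fun j k => fBethe η (t j - t k) with hf
  set g : Fin R → Fin R → ℂ := fun j k => Complex.sinh (2 * η) / Complex.sinh (t j - t k) with hg
  have hswap : ∀ j k, Complex.sinh (t j - t k) = -Complex.sinh (t k - t j) := fun j k => by
    rw [← Complex.sinh_neg, neg_sub]
  have hA := fun Y (j : Fin R) (hj : j ∉ Y) => action_on_bethe_vector
    (X := fun j => toLinAlgEquiv' (monodromy η ξ (t j) 0 0))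
    (B := fun j => toLinAlgEquiv' (opB η ξ (t j))) (φ := f) (γ := g)
    (x := fun j => aVac η ξ (t j)) hΨ
    (fun j k hjk => by
      simp only [← map_mul, ← map_smul, ← map_add, opA_mul_opB η ξ (ht j k hjk), hf, hg])
    (fun j => by rw [hΨ0, toLinAlgEquiv'_apply, (monodromy_vacuum η ξ (t j)).1])
    (fun j k l hjk hkl hjl => three_term_sinh (ht j k hjk) (ht k l hkl) (ht j l hjl)) Y hj
  have hD := fun Y (j : Fin R) (hj : j ∉ Y) => action_on_bethe_vector
    (X := fun j => toLinAlgEquiv' (monodromy η ξ (t j) 1 1))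
    (B := fun j => toLinAlgEquiv' (opB η ξ (t j))) (φ := fun j k => f k j) (γ := fun j k => -g j k)
    (x := fun j => dVac η ξ (t j)) hΨ
    (fun j k hjk => by
      simp only [← map_mul, ← map_smul, ← map_add, opD_mul_opB η ξ (ht j k hjk), hf, hg])
    (fun j => by rw [hΨ0, toLinAlgEquiv'_apply, (monodromy_vacuum η ξ (t j)).2.1])
    (fun j k l hjk hkl hjl => by
      have := three_term_sinh (η := η) (x := -t j) (y := -t k) (z := -t l)
        (by rw [neg_sub_neg]; exact ht k j hjk.symm) (by rw [neg_sub_neg]; exact ht l k hkl.symm)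
        (by rw [neg_sub_neg]; exact ht l j hjl.symm)
      simp only [neg_sub_neg] at this
      rw [hswap l j, hswap l k, hswap k j] at this
      simp only [hf, hg]
      linear_combination this) Y hj
  have hu : ∀ r : ℕ, Complex.exp (-((L - 2 * (r : ℂ)) * η))
      = Complex.exp (-((L - 2 * ((r + 1 : ℕ) : ℂ)) * η)) * Complex.exp (-(2 * η)) := fun r => by
    rw [← Complex.exp_add]; congr 1; push_cast; ring
  have hv : ∀ r : ℕ, Complex.exp ((L - 2 * (r : ℂ)) * η)
      = Complex.exp ((L - 2 * ((r + 1 : ℕ) : ℂ)) * η) * Complex.exp (2 * η) := fun r => by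
    rw [← Complex.exp_add]; congr 1; push_cast; ring
  have hlow := lowering_on_bethe_vector (s := toLinAlgEquiv' (SPlusXi 1 η ξ))
    (e := fun j => Complex.exp (t j)) (u := fun r => Complex.exp (-((L - 2 * (r : ℂ)) * η)))
    (v := fun r => Complex.exp ((L - 2 * (r : ℂ)) * η)) hΨ hA hD
    (by rw [hΨ0, toLinAlgEquiv'_apply, SPlusXi_vacuum η ξ one_ne_zero])
    (fun j Y hj => by
      simp only [toLinAlgEquiv'_apply]
      rw [mulVec_mulVec, opB, (SPlusXi_one_mul_monodromy η ξ (t j)).1, add_mulVec, smul_mulVec,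
        sub_mulVec, ← mulVec_mulVec, ← mulVec_mulVec, (expSpin_mul_monodromy η η ξ (t j)).2.2.2,
        ← mulVec_mulVec, hK, hK, mulVec_smul, mulVec_smul, mul_neg]
      module)
    (fun j k r hjk => by
      simp only [hu r, hf, hg]
      linear_combination Complex.exp (-((L - 2 * ((r + 1 : ℕ) : ℂ)) * η)) *
        (exp_mul_fBethe (ht j k hjk) η).1)
    (fun j k r hjk => by
      simp only [hv r, hf, hg]
      linear_combination Complex.exp ((L - 2 * ((r + 1 : ℕ) : ℂ)) * η) *
        (exp_mul_fBethe (ht j k hjk) η).2)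
  have hsum : ∀ T : Finset (Fin R), Complex.sinh (2 * η) * ∑ i ∈ T, ∏ j ∈ T.erase i, f i j
      = Complex.sinh (2 * T.card * η) := fun T =>
    sinh_mul_sum_prod_fBethe η t T fun i _ j _ hij => ht i j hij
  have hsum' : ∀ T : Finset (Fin R), Complex.sinh (2 * η) * ∑ i ∈ T, ∏ j ∈ T.erase i, f j i
      = Complex.sinh (2 * T.card * η) := fun T => by
    have := sinh_mul_sum_prod_fBethe η (fun i => -t i) T fun i _ j _ hij => by
      rw [neg_sub_neg]; exact ht j i hij.symm
    simpa only [neg_sub_neg] using this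
  have := dividedPower_on_bethe_vector (σ := fun n => toLinAlgEquiv' (SPlusXi n η ξ)) (c := L)
    (by simp only [SPlusXi_zero, map_one])
    (fun n => by simp only [← map_mul, ← map_smul, SPlusXi_mul_SPlusXi_one]) hsum hsum'
    hlow N hN Finset.univ
  rw [toLinAlgEquiv'_apply, Finset.card_univ, Fintype.card_fin, hΨdef, partialBetheVector_univ,
    ← hΨdef] at this
  rw [this]
  refine Finset.sum_congr rfl fun S hS => ?_
  rw [removalCoeff, (Finset.mem_powersetCard.1 hS).2]

/-! ### Continuity in the anisotropy parameter -/

theorem continuous_siteTensor {L : ℕ} {M : ℂ → Fin L → Matrix (Fin 2) (Fin 2) ℂ}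
    (hM : ∀ n, Continuous fun η => M η n) : Continuous fun η => siteTensor (M η) := by
  refine continuous_matrix fun s s' => ?_
  simp only [siteTensor, of_apply]
  exact continuous_finsetProd _ fun n _ => (hM n).matrix_elem _ _

theorem continuous_monodromy {L : ℕ} (ξ : Fin L → ℂ) (z : ℂ) :
    Continuous fun η => monodromy η ξ z := by
  have h : ∀ n, Continuous fun η => LOperator η n (z - ξ n) := fun n => by
    refine continuous_matrix fun a b => ?_
    simp only [LOperator_apply]
    refine continuous_siteTensor fun m => ?_
    split_ifs
    · refine continuous_matrix fun i j => ?_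
      fin_cases a <;> fin_cases b <;> fin_cases i <;> fin_cases j <;>
        simp [localL, sinhSigmaZ, sigmaPlus, sigmaMinus] <;> fun_prop
    · exact continuous_const
  simp only [monodromy, List.ofFn_eq_map, ← List.map_reverse]
  exact continuous_list_prod _ fun n _ => h n

theorem continuous_partialBetheVector {L R : ℕ} (ξ : Fin L → ℂ) (t : Fin R → ℂ)
    (Y : Finset (Fin R)) : Continuous fun η => partialBetheVector η ξ t Y := by
  refine Continuous.matrix_mulVec (continuous_list_prod _ fun j _ => ?_) continuous_const
  exact (continuous_monodromy ξ (t j)).matrix_elem 0 1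

theorem continuous_expSigmaZ {c : ℂ → ℂ} (hc : Continuous c) :
    Continuous fun η => expSigmaZ (c η) := by
  refine continuous_matrix fun i j => ?_
  fin_cases i <;> fin_cases j <;> simp [expSigmaZ] <;> fun_prop

theorem continuous_SPlusXi {L : ℕ} (N : ℕ) (ξ : Fin L → ℂ) :
    Continuous fun η => SPlusXi N η ξ := by
  simp only [SPlusXi_eq_sum]
  refine continuous_finsetSum _ fun J _ => continuous_siteTensor fun n => ?_
  split_ifs
  · exact continuous_const
  · exact continuous_expSigmaZ (by fun_prop)

theorem continuous_removalCoeff {L R : ℕ} (ξ : Fin L → ℂ) (t : Fin R → ℂ) (S : Finset (Fin R)) :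
    Continuous fun η => removalCoeff η ξ t S := by
  have hf : ∀ z, Continuous fun η => fBethe η z := fun z => by
    unfold fBethe
    fun_prop
  have ha : ∀ z, Continuous fun η => aVac η ξ z := fun z => by unfold aVac; fun_prop
  have hd : ∀ z, Continuous fun η => dVac η ξ z := fun z => by unfold dVac; fun_prop
  simp only [removalCoeff, removalSum, ← Complex.exp_neg]
  fun_prop

/-- Generic values of `η` accumulate at every value of `η`. -/
theorem eventually_sinh_mul_ne_zero {c : ℂ} (hc : c ≠ 0) (η₀ : ℂ) :
    ∀ᶠ η in 𝓝[≠] η₀, Complex.sinh (c * η) ≠ 0 := by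
  have han : AnalyticAt ℂ (fun η => Complex.sinh (c * η)) η₀ :=
    (Complex.differentiable_sinh.comp (differentiable_id.const_mul c)).analyticAt η₀
  refine han.eventually_eq_zero_or_eventually_ne_zero.resolve_left fun h => ?_
  have h0 : ∀ η, Complex.sinh (c * η) = 0 := fun η => by
    have hon : AnalyticOnNhd ℂ (fun η => Complex.sinh (c * η)) Set.univ := fun x _ =>
      (Complex.differentiable_sinh.comp (differentiable_id.const_mul c)).analyticAt x
    exact hon.eqOn_zero_of_preconnected_of_eventuallyEq_zero isPreconnected_univ
      (Set.mem_univ η₀) h (Set.mem_univ η)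
  have h1 := h0 (1 / c)
  rw [mul_one_div_cancel hc] at h1
  have : Real.sinh 1 = 0 := by
    rw [← Complex.ofReal_eq_zero, Complex.ofReal_sinh, Complex.ofReal_one, h1]
  exact one_ne_zero (Real.sinh_eq_zero.1 this)

/-- The action of the divided powers on Bethe vectors for all `q`, by continuity in `η` with the
roots held fixed. -/
theorem SPlusXi_mulVec_betheVector {L R : ℕ} {η₀ : ℂ} (ξ : Fin L → ℂ) {t : Fin R → ℂ}
    (ht : ∀ j k, j ≠ k → Complex.sinh (t j - t k) ≠ 0)
    (htη : ∀ j k, j ≠ k → Complex.sinh (t j - t k + 2 * η₀) ≠ 0) (N : ℕ) :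
    SPlusXi N η₀ ξ *ᵥ betheVector η₀ ξ t = ∑ S ∈ Finset.univ.powersetCard N,
      removalCoeff η₀ ξ t S • partialBetheVector η₀ ξ t (Finset.univ \ S) := by
  simp only [← partialBetheVector_univ]
  have hl : Continuous fun η => SPlusXi N η ξ *ᵥ partialBetheVector η ξ t Finset.univ :=
    (continuous_SPlusXi N ξ).matrix_mulVec (continuous_partialBetheVector ξ t _)
  have hr : Continuous fun η => ∑ S ∈ Finset.univ.powersetCard N,
      removalCoeff η ξ t S • partialBetheVector η ξ t (Finset.univ \ S) :=
    continuous_finsetSum _ fun S _ =>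
      (continuous_removalCoeff ξ t S).smul (continuous_partialBetheVector ξ t _)
  refine Filter.EventuallyEq.eq_of_nhds (f := fun η => SPlusXi N η ξ *ᵥ
    partialBetheVector η ξ t Finset.univ) (g := fun η => ∑ S ∈ Finset.univ.powersetCard N,
      removalCoeff η ξ t S • partialBetheVector η ξ t (Finset.univ \ S))
    ((hl.continuousAt.eventuallyEq_nhds_iff_eventuallyEq_nhdsNE hr.continuousAt).1 ?_)
  have h1 : ∀ᶠ η in 𝓝[≠] η₀, ∀ j k, j ≠ k → Complex.sinh (t j - t k + 2 * η) ≠ 0 := by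
    refine Filter.Eventually.filter_mono nhdsWithin_le_nhds ?_
    simp only [Filter.eventually_all]
    intro j k hjk
    refine ContinuousAt.eventually_ne ?_ (htη j k hjk)
    fun_prop
  have h2 : ∀ᶠ η in 𝓝[≠] η₀, ∀ k ∈ Set.Icc 1 N, Complex.sinh (2 * k * η) ≠ 0 := by
    refine (Filter.eventually_all_finite (Set.finite_Icc 1 N)).2 fun k hk => ?_
    refine eventually_sinh_mul_ne_zero (mul_ne_zero two_ne_zero ?_) η₀
    exact_mod_cast (Nat.one_le_iff_ne_zero.1 hk.1)
  filter_upwards [h1, h2] with η h1 h2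
  rw [partialBetheVector_univ]
  exact SPlusXi_mulVec_betheVector_of_generic ξ ht h1 fun k hk hkN => h2 k ⟨hk, hkN⟩

/-! ### Regular Bethe states at roots of unity -/

theorem sinh_eq_zero_iff_exp (x : ℂ) : Complex.sinh x = 0 ↔ Complex.exp (2 * x) = 1 := by
  have h := Complex.exp_ne_zero x
  rw [Complex.sinh, Complex.exp_neg, two_mul, Complex.exp_add]
  constructor <;> intro h1
  · field_simp at h1
    linear_combination h1
  · field_simp
    linear_combination h1

/-- On shell and at a root of unity all coefficients vanish. -/
theorem removalCoeff_eq_zero {L R N : ℕ} {η : ℂ} {ξ : Fin L → ℂ} {t : Fin R → ℂ}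
    (h : SolvesBetheEquations η ξ t) (hN : 0 < N)
    (hq : ∀ k, 0 < k → k < N → Complex.exp (2 * η) ^ (2 * k) ≠ 1)
    (hqN : (Complex.exp (2 * η) ^ N = 1 ∧ Odd N) ∨ (Complex.exp (2 * η) ^ N = -1 ∧ Even L))
    {S : Finset (Fin R)} (hS : S.card = N) : removalCoeff η ξ t S = 0 := by
  have hexp : ∀ k : ℕ, Complex.exp (2 * (2 * k * η)) = Complex.exp (2 * η) ^ (2 * k) := fun k => by
    rw [← Complex.exp_nat_mul]; congr 1; push_cast; ring
  refine removalSum_eq_zero (Finset.card_pos.1 (hS ▸ hN)) (η := η) (fun T _ => ?_)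
    (fun i _ j _ hij => h.f_ne_zero i j hij.symm) (fun i hi => ?_) (fun k hk hkN => ?_) ?_ ?_
  · have := sinh_mul_sum_prod_fBethe η (fun i => -t i) T fun i _ j _ hij => by
      rw [neg_sub_neg]; exact h.sinh_ne_zero j i hij
    simpa only [neg_sub_neg] using this
  · have hb := h.equation i
    rw [Finset.prod_div_distrib, div_eq_div_iff (h.d_ne_zero i) (Finset.prod_ne_zero_iff.2
      fun k hk => h.f_ne_zero i k (Finset.ne_of_mem_erase hk)),
      prod_erase_eq_mul_prod_sdiff (Finset.subset_univ S) hi,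
      prod_erase_eq_mul_prod_sdiff (Finset.subset_univ S) hi] at hb
    linear_combination Complex.exp (t i) * hb
  · rw [Ne, sinh_eq_zero_iff_exp, hexp]
    exact hq k hk (hS ▸ hkN)
  · rw [sinh_eq_zero_iff_exp, hexp, hS, mul_comm 2 N, pow_mul]
    rcases hqN with ⟨h1, -⟩ | ⟨h1, -⟩ <;> rw [h1] <;> norm_num
  · -- `ρ ^ (2 N) = (q ^ N) ^ (L - 2 R + N + 1)`
    have hρ : Complex.exp ((L - 2 * R + S.card + 1) * η) ^ (2 * N)
        * (Complex.exp (2 * η) ^ N) ^ (2 * R) = (Complex.exp (2 * η) ^ N) ^ (L + N + 1) := by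
      rw [hS]
      simp only [← Complex.exp_nat_mul, ← Complex.exp_add]
      congr 1
      push_cast
      ring
    set ρ := Complex.exp ((L - 2 * R + S.card + 1) * η) with hρdef
    have hρ0 : ρ ≠ 0 := Complex.exp_ne_zero _
    have key : (-1) ^ N * ρ ^ (2 * N) = -1 := by
      rcases hqN with ⟨h1, h2⟩ | ⟨h1, h2⟩
      · rw [h1, one_pow, one_pow, mul_one] at hρ
        rw [hρ, h2.neg_one_pow, mul_one]
      · rw [h1, (even_two_mul R).neg_one_pow, mul_one] at hρ
        rw [hρ, ← pow_add, Odd.neg_one_pow]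
        obtain ⟨r, rfl⟩ := h2
        exact ⟨r + N, by ring⟩
    refine (mul_eq_zero.1 (?_ : ρ ^ N * (ρ⁻¹ ^ S.card + (-ρ) ^ S.card) = 0)).resolve_left
      (pow_ne_zero _ hρ0)
    rw [hS, mul_add, ← mul_pow, mul_inv_cancel₀ hρ0, one_pow, neg_pow ρ]
    linear_combination key

theorem SPlusXi_mulVec_betheVector_eq_zero {L R N : ℕ} {η : ℂ} {ξ : Fin L → ℂ} {t : Fin R → ℂ}
    (h : SolvesBetheEquations η ξ t) (hN : 0 < N)
    (hq : ∀ k, 0 < k → k < N → Complex.exp (2 * η) ^ (2 * k) ≠ 1)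
    (hqN : (Complex.exp (2 * η) ^ N = 1 ∧ Odd N) ∨ (Complex.exp (2 * η) ^ N = -1 ∧ Even L)) :
    SPlusXi N η ξ *ᵥ betheVector η ξ t = 0 := by
  rw [SPlusXi_mulVec_betheVector ξ fun j k hjk => h.sinh_ne_zero j k hjk.symm]
  · refine Finset.sum_eq_zero fun S hS => ?_
    rw [removalCoeff_eq_zero h hN hq hqN (Finset.mem_powersetCard.1 hS).2, zero_smul]
  · intro j k hjk h0
    refine h.f_ne_zero k j hjk ?_
    have e : t k - t j - 2 * η = -(t j - t k + 2 * η) := by ring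
    rw [fBethe, e, Complex.sinh_neg, h0, neg_zero, zero_div]

/-! ### The reflection exchanging the two quantum groups -/

/-- `T_ξ^{+(N)}` is `S_ξ^{+(N)}` with `η` and `ξ` reversed. -/
theorem TPlusXi_eq_SPlusXi_neg {L : ℕ} (N : ℕ) (η : ℂ) (ξ : Fin L → ℂ) :
    TPlusXi N η ξ = SPlusXi N (-η) (-ξ) := by
  simp [TPlusXi, SPlusXi, VPlus, VMinus, TPlus, SPlus, neg_div]

theorem opB_neg {L : ℕ} (η : ℂ) (ξ : Fin L → ℂ) (z : ℂ) :
    opB (-η) (-ξ) (-z) = (-1) ^ L * opB η ξ z := by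
  have hL : ∀ n : Fin L, LOperator (-η) n (-z - (-ξ) n) = -LOperator η n (z - ξ n) := fun n => by
    have e : -z - (-ξ) n = -(z - ξ n) := by simp; ring
    have hneg : ∀ M : Matrix (Fin 2) (Fin 2) ℂ, onSite n (-M) = -onSite n M := fun M => by
      have := siteTensor_smul (fun i => if i = n then (-1 : ℂ) else 1)
        fun i => if i = n then M else 1
      rw [Finset.prod_ite_eq', if_pos (Finset.mem_univ n), neg_one_smul] at this
      rw [onSite, onSite, ← this]
      congr 1
      funext i
      split_ifs <;> simp
    ext1 a b
    rw [neg_apply, LOperator_apply, LOperator_apply, ← hneg, e]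
    congr 1
    ext i j
    generalize z - ξ n = w
    have e1 : -w + -η = -(w + η) := by ring
    have e2 : -w + η = -(w - η) := by ring
    have e3 : -w - η = -(w + η) := by ring
    fin_cases a <;> fin_cases b <;> fin_cases i <;> fin_cases j <;>
      simp [localL, sinhSigmaZ, sigmaPlus, sigmaMinus, ← sub_eq_add_neg, e1, e2, e3,
        Complex.sinh_neg, -neg_add_rev, -neg_sub]
  have h : monodromy (-η) (-ξ) (-z) = (-1) ^ L * monodromy η ξ z := by
    have := List.prod_map_neg ((List.ofFn fun n : Fin L => LOperator η n (z - ξ n)).reverse)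
    rw [List.length_reverse, List.length_ofFn, List.map_reverse, List.map_ofFn] at this
    rw [monodromy, monodromy, ← this]
    simp only [hL]
    rfl
  rw [opB, opB, h]
  rcases L.even_or_odd with hL | hL <;> simp [hL.neg_one_pow]

theorem betheVector_neg {L R : ℕ} (η : ℂ) (ξ : Fin L → ℂ) (t : Fin R → ℂ) :
    betheVector (-η) (-ξ) (-t) = betheVector η ξ t ∨
      betheVector (-η) (-ξ) (-t) = -betheVector η ξ t := by
  rcases L.even_or_odd with hL | hL
  · left
    simp [betheVector, opB_neg, hL.neg_one_pow]
  · have h := List.prod_map_neg (List.ofFn fun j => opB η ξ (t j))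
    have h1 : betheVector (-η) (-ξ) (-t)
        = ((-1) ^ R * (List.ofFn fun j => opB η ξ (t j)).prod) *ᵥ vacuum L := by
      rw [List.length_ofFn, List.map_ofFn] at h
      rw [← h, betheVector]
      simp only [Pi.neg_apply, opB_neg, hL.neg_one_pow, neg_one_mul]
      rfl
    rw [h1, betheVector]
    rcases R.even_or_odd with hR | hR <;> simp [hR.neg_one_pow, neg_mulVec]

theorem SolvesBetheEquations.neg {L R : ℕ} {η : ℂ} {ξ : Fin L → ℂ} {t : Fin R → ℂ}
    (h : SolvesBetheEquations η ξ t) : SolvesBetheEquations (-η) (-ξ) (-t) := by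
  have e : ∀ x y : ℂ, -x - -y = -(x - y) := fun x y => by ring
  have hf : ∀ j k, fBethe (-η) (-t j - -t k) = fBethe η (t j - t k) := fun j k => by
    have e2 : -(t j - t k) - 2 * -η = -(t j - t k - 2 * η) := by ring
    rw [e, fBethe, fBethe, e2, Complex.sinh_neg, Complex.sinh_neg, neg_div_neg_eq]
  have ha : ∀ z, aVac (-η) (-ξ) (-z) = (-1) ^ L * aVac η ξ z := fun z => by
    have e2 : ∀ n, -z - -ξ n + -η = -(z - ξ n + η) := fun n => by ring
    simp only [aVac, Pi.neg_apply, e2, Complex.sinh_neg, Finset.prod_neg, Finset.card_univ,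
      Fintype.card_fin]
  have hd : ∀ z, dVac (-η) (-ξ) (-z) = (-1) ^ L * dVac η ξ z := fun z => by
    have e2 : ∀ n, -z - -ξ n - -η = -(z - ξ n - η) := fun n => by ring
    simp only [dVac, Pi.neg_apply, e2, Complex.sinh_neg, Finset.prod_neg, Finset.card_univ,
      Fintype.card_fin]
  have h1 : ((-1 : ℂ)) ^ L ≠ 0 := pow_ne_zero _ (neg_ne_zero.2 one_ne_zero)
  refine ⟨fun j => ?_, fun j k hjk => ?_, fun j k hjk => ?_, fun j => ?_⟩
  · rw [Pi.neg_apply, hd]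
    exact mul_ne_zero h1 (h.d_ne_zero j)
  · rw [Pi.neg_apply, Pi.neg_apply, e, Complex.sinh_neg]
    exact neg_ne_zero.2 (h.sinh_ne_zero j k hjk)
  · rw [Pi.neg_apply, Pi.neg_apply, hf]
    exact h.f_ne_zero j k hjk
  · simp only [Pi.neg_apply, ha, hd, hf]
    rw [mul_div_mul_left _ _ h1, h.equation j]

theorem loop_generators_annihilate {L R N : ℕ} {η : ℂ} {ξ : Fin L → ℂ} {t : Fin R → ℂ}
    (h : SolvesBetheEquations η ξ t) (hN : 0 < N)
    (hq : ∀ k, 0 < k → k < N → Complex.exp (2 * η) ^ (2 * k) ≠ 1)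
    (hqN : (Complex.exp (2 * η) ^ N = 1 ∧ Odd N) ∨ (Complex.exp (2 * η) ^ N = -1 ∧ Even L)) :
    SPlusXi N η ξ *ᵥ betheVector η ξ t = 0 ∧ TPlusXi N η ξ *ᵥ betheVector η ξ t = 0 := by
  refine ⟨SPlusXi_mulVec_betheVector_eq_zero h hN hq hqN, ?_⟩
  have he : Complex.exp (2 * -η) = (Complex.exp (2 * η))⁻¹ := by rw [mul_neg, Complex.exp_neg]
  have := SPlusXi_mulVec_betheVector_eq_zero h.neg hN
    (fun k hk hkN => by
      rw [he, inv_pow, Ne, inv_eq_one]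
      exact hq k hk hkN)
    (by rw [he, inv_pow, inv_eq_one, inv_eq_iff_eq_inv, inv_neg, inv_one]; exact hqN)
  rw [TPlusXi_eq_SPlusXi_neg]
  rcases betheVector_neg η ξ t with h1 | h1 <;> rw [h1] at this
  · exact this
  · rwa [mulVec_neg, neg_eq_zero] at this

end

end XXZ

theorem proposition2 (L R N : ℕ) (η₀ : ℂ) (ξ : Fin L → ℂ) (t : Fin R → ℂ)
    (hstate : XXZ.IsRegularBetheState η₀ ξ t)
    (hisolated : XXZ.IsIsolatedBetheSolution η₀ ξ t) :
    (Even L → XXZ.IsRootOfUnityType (Complex.exp (2 * η₀)) N →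
      (XXZ.SPlusXi N η₀ ξ).mulVec (XXZ.betheVector η₀ ξ t) = 0 ∧
      (XXZ.TPlusXi N η₀ ξ).mulVec (XXZ.betheVector η₀ ξ t) = 0) ∧
    (Odd L → Odd N → IsPrimitiveRoot (Complex.exp (2 * η₀)) N →
      (XXZ.SPlusXi N η₀ ξ).mulVec (XXZ.betheVector η₀ ξ t) = 0 ∧
      (XXZ.TPlusXi N η₀ ξ).mulVec (XXZ.betheVector η₀ ξ t) = 0) := by
  have h := hstate.roots.solves
  have hodd : Odd N → IsPrimitiveRoot (Complex.exp (2 * η₀)) N →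
      (XXZ.SPlusXi N η₀ ξ).mulVec (XXZ.betheVector η₀ ξ t) = 0 ∧
        (XXZ.TPlusXi N η₀ ξ).mulVec (XXZ.betheVector η₀ ξ t) = 0 := fun hN hq =>
    XXZ.loop_generators_annihilate h hN.pos
      (fun k hk hkN h1 => Nat.not_dvd_of_pos_of_lt hk hkN
        (hN.coprime_two_right.dvd_of_dvd_mul_left (hq.dvd_of_pow_eq_one _ h1)))
      (Or.inl ⟨hq.pow_eq_one, hN⟩)
  have heven : 0 < N → Even L → IsPrimitiveRoot (Complex.exp (2 * η₀)) (2 * N) →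
      (XXZ.SPlusXi N η₀ ξ).mulVec (XXZ.betheVector η₀ ξ t) = 0 ∧
        (XXZ.TPlusXi N η₀ ξ).mulVec (XXZ.betheVector η₀ ξ t) = 0 := fun hN hL hq =>
    XXZ.loop_generators_annihilate h hN
      (fun k hk hkN h1 => Nat.not_dvd_of_pos_of_lt (by omega) (by omega)
        (hq.dvd_of_pow_eq_one _ h1))
      (Or.inr ⟨(hq.pow (by omega) (mul_comm 2 N)).eq_neg_one_of_two_right, hL⟩)
  refine ⟨fun hL hq => ?_, fun _ hN hq => hodd hN hq⟩
  obtain ⟨hN, ⟨hq, hN'⟩ | ⟨hq, -⟩ | ⟨hq, -⟩⟩ := hq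
  · exact hodd hN' hq
  · exact heven hN hL hq
  · exact heven hN hL hq
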